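/- Let $F,\nu>0$, and let $(\bar\tau,\bar u)(x-ct)$ be a roll wave of the St. Venant system $$\partial_t\tau-\partial_x u=0,\qquad \partial_t u+\partial_x\Big(\frac{\tau^{-2}}{2F^2}\Big)=1-\tau u^2+\nu\,\partial_x(\tau^{-2}\partial_x u),$$ that is, $\bar\tau>0$ and $\bar u$ are $C^2$ real functions on $\mathbb R$, jointly periodic with fundamental (least positive) period $\Xi>0$, solving $$-c\bar\tau_x-\bar u_x=0,\qquad -c\bar u_x+\big((2F^2)^{-1}\bar\tau^{-2}\big)_x=1-\bar\tau\bar u^2+\nu(\bar\tau^{-2}\bar u_x)_x .$$ No further condition (in particular no slope condition $2\nu\bar u_x<F^{-2}$) is assumed. Put $\alpha:=\bar\tau^{-3}(F^{-2}-2\nu\bar u_x)$. The linearization of the system about the wave, in the co-moving frame, is $U_t=LU$ with $U=(\tau,u)$ and $$L(\tau,u)=\big(c\,\tau_x+u_x,\ \ c\,u_x+(\alpha\tau)_x+\nu(\bar\tau^{-2}u_x)_x-\bar u^2\tau-2\bar u\bar\tau u\big).$$ For $\xi\in[-\pi/\Xi,\pi/\Xi)$ let $L_\xi:=e^{-i\xi\cdot}Le^{i\xi\cdot}$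 be its Bloch symbol (replace $\partial_x$ by $\partial_x+i\xi$) acting on $\Xi$-periodic functions, considered for a positive integer $s$ as an unbounded operator on $H^s_{per}(0,\Xi;\mathbb C^2)$ with domain $\{U\in H^s_{per}: L_\xi U\in H^s_{per}\}$, and let $$\|f\|_{H^s_\xi}=\Big(\sum_{k=0}^s\|(\partial_x+i\xi)^kf\|_{L^2(0,\Xi)}^2\Big)^{1/2}.$$ Proposition (Resolvent bounds). For every positive integer $s$ there exist $\eta,C,R>0$ such that, for every $\xi\in[-\pi/\Xi,\pi/\Xi)$ and every $\lambda\in\mathbb C$ with $|\lambda|\ge R$ and $\operatorname{Re}\lambda\ge-\eta$, $$\lambda\notin\sigma_{H^s_{per}(0,\Xi)}(L_\xi)\qquad\text{and}\qquad \|(\lambda-L_\xi)^{-1}\|_{H^s_\xi\to H^s_\xi}\le C .$$ -/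

import Mathlib

open MeasureTheory

noncomputable section

namespace StVenant

/-! ### Roll waves -/

/-- `(τ, u)` is a roll wave of speed `c` and fundamental period `Ξ` of the St. Venant system
`τ_t - u_x = 0`, `u_t + (τ⁻² / (2 F²))_x = 1 - τ u² + ν (τ⁻² u_x)_x`, that is,
`(x, t) ↦ (τ (x - c t), u (x - c t))` is a (classical) solution with `τ > 0`. -/
structure IsRollWave (F ν c Ξ : ℝ) (τ u : ℝ → ℝ) : Prop where
  contDiff_tau : ContDiff ℝ 2 τ
  contDiff_u : ContDiff ℝ 2 u
  tau_pos : ∀ x, 0 < τ x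
  fundamental_period :
    IsLeast {p : ℝ | 0 < p ∧ Function.Periodic τ p ∧ Function.Periodic u p} Ξ
  profile_tau : ∀ x, -c * deriv τ x - deriv u x = 0
  profile_u : ∀ x,
    -c * deriv u x + deriv (fun y => (2 * F ^ 2)⁻¹ * (τ y ^ 2)⁻¹) x
      = 1 - τ x * u x ^ 2 + ν * deriv (fun y => (τ y ^ 2)⁻¹ * deriv u y) x

/-- The coefficient `α = τ⁻³ (F⁻² - 2 ν u_x)` of the linearized system: the function such that
`- α σ` is the derivative of `τ⁻² / (2 F²) - ν τ⁻² u_x` with respect to `τ`, in the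
direction `σ`. -/
def alpha (F ν : ℝ) (τ u : ℝ → ℝ) (x : ℝ) : ℝ :=
  (τ x ^ 3)⁻¹ * ((F ^ 2)⁻¹ - 2 * ν * deriv u x)

/-! ### Periodic Sobolev spaces -/

/-- Lebesgue measure on one period `(0, Ξ)`. -/
abbrev periodMeasure (Ξ : ℝ) : Measure ℝ := volume.restrict (Set.Ioc 0 Ξ)

/-- `L²(0, Ξ)`, complex valued. -/
abbrev L2Per (Ξ : ℝ) : Type := Lp ℂ 2 (periodMeasure Ξ)

/-- `g = (∂ₓ + i ξ) f` weakly, for (the `Ξ`-periodic extensions of) `f, g ∈ L²(0, Ξ)`.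
Note that `(∂ₓ + i ξ) f = e^{-i ξ x} ∂ₓ (e^{i ξ x} f)`, and that `∂ₓ + i ξ` has
formal transpose `-∂ₓ + i ξ`. -/
def HasWeakBlochDeriv (Ξ ξ : ℝ) (f g : ℝ → ℂ) : Prop :=
  MemLp f 2 (periodMeasure Ξ) ∧ MemLp g 2 (periodMeasure Ξ) ∧
    ∀ φ : ℝ → ℂ, ContDiff ℝ (⊤ : ℕ∞) φ → Function.Periodic φ Ξ →
      ∫ x, g x * φ x ∂(periodMeasure Ξ)
        = ∫ x, f x * (-deriv φ x + Complex.I * (ξ : ℂ) * φ x) ∂(periodMeasure Ξ)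

section helpers

variable {Ξ ξ : ℝ} {f g f' g' : ℝ → ℂ}

lemma HasWeakBlochDeriv.congr (h : HasWeakBlochDeriv Ξ ξ f g)
    (hf : f =ᵐ[periodMeasure Ξ] f') (hg : g =ᵐ[periodMeasure Ξ] g') :
    HasWeakBlochDeriv Ξ ξ f' g' := by
  refine ⟨(memLp_congr_ae hf).1 h.1, (memLp_congr_ae hg).1 h.2.1, fun φ hφ hp => ?_⟩
  rw [← integral_congr_ae (hg.mono fun x hx => by simp only [hx] :
      (fun x => g x * φ x) =ᵐ[periodMeasure Ξ] fun x => g' x * φ x),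
    ← integral_congr_ae (hf.mono fun x hx => by simp only [hx] :
      (fun x => f x * (-deriv φ x + Complex.I * (ξ : ℂ) * φ x)) =ᵐ[periodMeasure Ξ]
        fun x => f' x * (-deriv φ x + Complex.I * (ξ : ℂ) * φ x))]
  exact h.2.2 φ hφ hp

lemma integrable_mul_of_continuous {h : ℝ → ℂ} (hh : MemLp h 2 (periodMeasure Ξ))
    {φ : ℝ → ℂ} (hφ : Continuous φ) :
    Integrable (fun x => h x * φ x) (periodMeasure Ξ) := by
  have h1 : Integrable h (periodMeasure Ξ) := hh.integrable (by norm_num)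
  obtain ⟨M, hM⟩ := (isCompact_Icc (a := (0 : ℝ)) (b := Ξ)).exists_bound_of_continuousOn
    hφ.continuousOn
  refine h1.mul_bdd (c := M) hφ.aestronglyMeasurable ?_
  filter_upwards [ae_restrict_mem measurableSet_Ioc] with x hx
  exact hM x ⟨hx.1.le, hx.2⟩

lemma continuous_test {φ : ℝ → ℂ} (hφ : ContDiff ℝ (⊤ : ℕ∞) φ) :
    Continuous fun x => -deriv φ x + Complex.I * (ξ : ℂ) * φ x :=
  (hφ.continuous_deriv (by simp)).neg.add (continuous_const.mul hφ.continuous)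

lemma HasWeakBlochDeriv.add (h : HasWeakBlochDeriv Ξ ξ f g) (h' : HasWeakBlochDeriv Ξ ξ f' g') :
    HasWeakBlochDeriv Ξ ξ (f + f') (g + g') := by
  refine ⟨h.1.add h'.1, h.2.1.add h'.2.1, fun φ hφ hp => ?_⟩
  simp only [Pi.add_apply, add_mul]
  rw [integral_add (integrable_mul_of_continuous h.2.1 hφ.continuous)
      (integrable_mul_of_continuous h'.2.1 hφ.continuous),
    integral_add (integrable_mul_of_continuous h.1 (continuous_test hφ))
      (integrable_mul_of_continuous h'.1 (continuous_test hφ)),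
    h.2.2 φ hφ hp, h'.2.2 φ hφ hp]

lemma HasWeakBlochDeriv.smul (a : ℂ) (h : HasWeakBlochDeriv Ξ ξ f g) :
    HasWeakBlochDeriv Ξ ξ (a • f) (a • g) := by
  refine ⟨h.1.const_smul a, h.2.1.const_smul a, fun φ hφ hp => ?_⟩
  simp only [Pi.smul_apply, smul_eq_mul, mul_assoc]
  rw [integral_const_mul, integral_const_mul, h.2.2 φ hφ hp]
  simp only [mul_assoc]

lemma HasWeakBlochDeriv.zero : HasWeakBlochDeriv Ξ ξ 0 0 :=
  ⟨MemLp.zero, MemLp.zero, fun φ _ _ => by simp⟩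

/-- The weak derivative is unique. -/
lemma HasWeakBlochDeriv.eq_zero (h : HasWeakBlochDeriv Ξ ξ f g)
    (hf : f =ᵐ[periodMeasure Ξ] 0) : g =ᵐ[periodMeasure Ξ] 0 := by
  have h0 := h.congr hf (Filter.EventuallyEq.refl _ g)
  rcases le_or_gt Ξ 0 with hΞ | hΞ
  · have : periodMeasure Ξ = 0 := by simp [periodMeasure, Set.Ioc_eq_empty (not_lt.2 hΞ)]
    rw [this, ae_zero]; exact Filter.eventually_bot
  have : Fact (0 < Ξ) := ⟨hΞ⟩
  have hc : ∀ n : ℤ, fourierCoeffOn hΞ g n = 0 := by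
    intro n
    rw [fourierCoeffOn_eq_integral]
    have e : ∀ x : ℝ, fourier (-n) (x : AddCircle (Ξ - 0))
        = Complex.exp (2 * Real.pi * Complex.I * (-n : ℤ) * x / Ξ) := by
      intro x
      rw [fourier_coe_apply]; simp
    have key := h0.2.2 (fun x => Complex.exp (2 * Real.pi * Complex.I * (-n : ℤ) * x / Ξ)) ?_ ?_
    · simp only [Pi.zero_apply, zero_mul, integral_zero] at key
      rw [intervalIntegral.integral_of_le hΞ.le]
      simp only [e, smul_eq_mul]
      simp only [mul_comm _ (g _), key]
      simp
    · have : ContDiff ℝ (⊤ : ℕ∞) fun x : ℝ => (x : ℂ) := Complex.ofRealCLM.contDiff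
      fun_prop
    · intro x
      have := (fourier (T := Ξ) (-n)).1
      have e1 : ∀ x : ℝ, Complex.exp (2 * Real.pi * Complex.I * (-n : ℤ) * x / Ξ)
          = fourier (-n) (x : AddCircle Ξ) := fun x => (fourier_coe_apply).symm
      simp only [e1]
      rw [AddCircle.coe_add_period]
  have hs := hasSum_sq_fourierCoeffOn hΞ h.2.1
  simp only [hc, norm_zero, ne_eq, OfNat.ofNat_ne_zero, not_false_eq_true, zero_pow] at hs
  have h2 := hs.unique hasSum_zero
  rw [smul_eq_zero, sub_zero] at h2
  have h3 := h2.resolve_left (inv_ne_zero hΞ.ne')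
  rw [intervalIntegral.integral_of_le hΞ.le,
    integral_eq_zero_iff_of_nonneg (fun x => by positivity)
      ((memLp_two_iff_integrable_sq_norm h.2.1.1).1 h.2.1)] at h3
  exact h3.mono fun x hx => by simpa using hx

end helpers

/-- `H^s_per(0, Ξ)` with the norm `‖f‖_{H^s_ξ} = (∑_{k ≤ s} ‖(∂ₓ + i ξ)^k f‖²_{L²(0, Ξ)})^{1/2}`.
An element `f` is stored together with its weak derivatives, as the tuple
`(f, (∂ₓ + i ξ) f, …, (∂ₓ + i ξ)^s f)` of elements of `L²(0, Ξ)`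
(which is determined by `f`), and the norm is that of the `ℓ²`-sum. -/
def HPer (Ξ ξ : ℝ) (s : ℕ) : Submodule ℂ (PiLp 2 fun _ : Fin (s + 1) => L2Per Ξ) where
  carrier := {f | ∀ k : Fin s, HasWeakBlochDeriv Ξ ξ (f k.castSucc) (f k.succ)}
  add_mem' ha hb k :=
    ((ha k).add (hb k)).congr (Lp.coeFn_add _ _).symm (Lp.coeFn_add _ _).symm
  zero_mem' k :=
    HasWeakBlochDeriv.zero.congr (Lp.coeFn_zero _ _ _).symm (Lp.coeFn_zero _ _ _).symm
  smul_mem' a f hf k :=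
    ((hf k).smul a).congr (Lp.coeFn_smul _ _).symm (Lp.coeFn_smul _ _).symm

/-- The function on `(0, Ξ)` underlying an element of `H^s_per(0, Ξ)`. -/
def perFn {Ξ ξ : ℝ} {s : ℕ} (f : HPer Ξ ξ s) : ℝ → ℂ := f.1 0

/-- `H^s_per(0, Ξ; ℂ²)`: pairs `U = (τ, u)`, with `‖U‖² = ‖τ‖²_{H^s_ξ} + ‖u‖²_{H^s_ξ}`. -/
abbrev HPer2 (Ξ ξ : ℝ) (s : ℕ) : Type := WithLp 2 (HPer Ξ ξ s × HPer Ξ ξ s)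

section helpers

variable {Ξ ξ : ℝ} {s : ℕ}

lemma perFn_add (f g : HPer Ξ ξ s) : perFn (f + g) =ᵐ[periodMeasure Ξ] perFn f + perFn g :=
  Lp.coeFn_add _ _

lemma perFn_smul (a : ℂ) (f : HPer Ξ ξ s) : perFn (a • f) =ᵐ[periodMeasure Ξ] a • perFn f :=
  Lp.coeFn_smul _ _

lemma perFn_zero : perFn (0 : HPer Ξ ξ s) =ᵐ[periodMeasure Ξ] 0 :=
  Lp.coeFn_zero _ _ _

/-- Elements of `H^s_per(0, Ξ)` are determined by their underlying functions. -/
lemma HPer.ext_zero (f : HPer Ξ ξ s) (hf : perFn f =ᵐ[periodMeasure Ξ] 0) : f = 0 := by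
  have h : ∀ k : Fin (s + 1), (f.1 k : ℝ → ℂ) =ᵐ[periodMeasure Ξ] 0 := by
    intro k
    induction k using Fin.induction with
    | zero => exact hf
    | succ k ih => exact (f.2 k).eq_zero ih
  apply Subtype.ext
  ext1 k
  exact Lp.ext ((h k).trans (Lp.coeFn_zero _ _ _).symm)

end helpers

/-! ### The Bloch symbols of the linearized operator -/

/-- `(g₁, g₂) = L_ξ (τ, u)`, where, with `D = ∂ₓ + i ξ` and the wave `(τb, ub)`,
`L_ξ (τ, u) = (c D τ + D u, c D u + D (α τ) + ν D (τb⁻² D u) - ub² τ - 2 ub τb u)`,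
all derivatives being weak derivatives of periodic functions. In the second component the
derivatives are collected into that of the flux `c u + α τ + ν τb⁻² D u`. -/
def IsBlochImage (F ν c Ξ : ℝ) (τb ub : ℝ → ℝ) (ξ : ℝ) (τ u g₁ g₂ : ℝ → ℂ) : Prop :=
  ∃ dτ du : ℝ → ℂ, HasWeakBlochDeriv Ξ ξ τ dτ ∧ HasWeakBlochDeriv Ξ ξ u du ∧
    g₁ =ᵐ[periodMeasure Ξ] (fun x => (c : ℂ) * dτ x + du x) ∧
    HasWeakBlochDeriv Ξ ξ
      (fun x => (c : ℂ) * u x + (alpha F ν τb ub x : ℂ) * τ x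
        + (ν : ℂ) * (((τb x ^ 2)⁻¹ : ℝ) : ℂ) * du x)
      (fun x => g₂ x + ((ub x ^ 2 : ℝ) : ℂ) * τ x + ((2 * ub x * τb x : ℝ) : ℂ) * u x)

/-- The graph of `L_ξ` on `H^s_per(0, Ξ)`: all pairs `(U, L_ξ U)` with
`U ∈ H^s_per(0, Ξ)` and `L_ξ U ∈ H^s_per(0, Ξ)` (for `s ≥ 1` the first weak derivatives of
`U` in `IsBlochImage` exist automatically). -/
def blochGraph (F ν c Ξ : ℝ) (τb ub : ℝ → ℝ) (ξ : ℝ) (s : ℕ) :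
    Submodule ℂ (HPer2 Ξ ξ s × HPer2 Ξ ξ s) where
  carrier := {p | IsBlochImage F ν c Ξ τb ub ξ (perFn p.1.fst) (perFn p.1.snd)
    (perFn p.2.fst) (perFn p.2.snd)}
  add_mem' {a b} := by
    rintro ⟨dτ, du, h1, h2, h3, h4⟩ ⟨dτ', du', h1', h2', h3', h4'⟩
    have e1 := perFn_add a.1.fst b.1.fst
    have e2 := perFn_add a.1.snd b.1.snd
    have e3 := perFn_add a.2.fst b.2.fst
    have e4 := perFn_add a.2.snd b.2.snd
    refine ⟨dτ + dτ', du + du', (h1.add h1').congr e1.symm (.refl _ _),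
      (h2.add h2').congr e2.symm (.refl _ _), ?_, (h4.add h4').congr ?_ ?_⟩
    · refine e3.trans ?_
      filter_upwards [h3, h3'] with x hx hx'
      simp only [Pi.add_apply, hx, hx']; ring
    · refine Filter.EventuallyEq.symm ?_
      filter_upwards [e1, e2] with x hx hx'
      simp only [Prod.fst_add, WithLp.add_fst, WithLp.add_snd, hx, hx', Pi.add_apply]; ring
    · refine Filter.EventuallyEq.symm ?_
      filter_upwards [e1, e2, e4] with x hx hx' hx''
      simp only [Prod.fst_add, Prod.snd_add, WithLp.add_fst, WithLp.add_snd, hx, hx', hx'',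
        Pi.add_apply]
      ring
  zero_mem' := by
    have e := perFn_zero (Ξ := Ξ) (ξ := ξ) (s := s)
    refine ⟨0, 0, HasWeakBlochDeriv.zero.congr e.symm (.refl _ _),
      HasWeakBlochDeriv.zero.congr e.symm (.refl _ _), e.trans ?_,
      HasWeakBlochDeriv.zero.congr ?_ ?_⟩
    · exact .of_forall fun x => by simp
    · refine Filter.EventuallyEq.symm (e.mono fun x hx => ?_)
      simp [hx]
    · refine Filter.EventuallyEq.symm (e.mono fun x hx => ?_)
      simp [hx]
  smul_mem' r a := by
    rintro ⟨dτ, du, h1, h2, h3, h4⟩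
    have e1 := perFn_smul r a.1.fst
    have e2 := perFn_smul r a.1.snd
    have e3 := perFn_smul r a.2.fst
    have e4 := perFn_smul r a.2.snd
    refine ⟨r • dτ, r • du, (h1.smul r).congr e1.symm (.refl _ _),
      (h2.smul r).congr e2.symm (.refl _ _), ?_, (h4.smul r).congr ?_ ?_⟩
    · refine e3.trans ?_
      filter_upwards [h3] with x hx
      simp only [Pi.smul_apply, smul_eq_mul, hx]; ring
    · refine Filter.EventuallyEq.symm ?_
      filter_upwards [e1, e2] with x hx hx'
      simp only [Prod.smul_fst, WithLp.smul_fst, WithLp.smul_snd, hx, hx', Pi.smul_apply,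
        smul_eq_mul]
      ring
    · refine Filter.EventuallyEq.symm ?_
      filter_upwards [e1, e2, e4] with x hx hx' hx''
      simp only [Prod.smul_fst, Prod.smul_snd, WithLp.smul_fst, WithLp.smul_snd, hx, hx', hx'',
        Pi.smul_apply, smul_eq_mul]
      ring

/-- `L_ξ`, as an unbounded operator on `H^s_per(0, Ξ)` with domain
`{U ∈ H^s_per(0, Ξ) | L_ξ U ∈ H^s_per(0, Ξ)}`. -/
def blochOperator (F ν c Ξ : ℝ) (τb ub : ℝ → ℝ) (ξ : ℝ) (s : ℕ) :
    HPer2 Ξ ξ s →ₗ.[ℂ] HPer2 Ξ ξ s :=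
  (blochGraph F ν c Ξ τb ub ξ s).toLinearPMap

/-- `L_ξ` is well defined: its graph is `blochGraph`. -/
lemma blochOperator_graph (F ν c Ξ : ℝ) (τb ub : ℝ → ℝ) (ξ : ℝ) (s : ℕ) :
    (blochOperator F ν c Ξ τb ub ξ s).graph = blochGraph F ν c Ξ τb ub ξ s := by
  refine Submodule.toLinearPMap_graph_eq _ ?_
  rintro ⟨U, G⟩ ⟨dτ, du, h1, h2, h3, h4⟩ (rfl : U = 0)
  have e : perFn (0 : HPer Ξ ξ s) =ᵐ[periodMeasure Ξ] 0 := perFn_zero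
  have z1 := h1.eq_zero e
  have z2 := h2.eq_zero e
  have z4 := h4.eq_zero (by
    filter_upwards [e, z2] with x hx hx'
    simp [hx, hx'])
  have g1 : G.fst = 0 := HPer.ext_zero _ (by
    filter_upwards [h3, z1, z2] with x hx hx' hx''
    simp [hx, hx', hx''])
  have g2 : G.snd = 0 := HPer.ext_zero _ (by
    filter_upwards [z4, e] with x hx hx'
    simpa [hx'] using hx)
  exact (WithLp.equiv 2 _).injective (Prod.ext g1 g2)

/-! ### Spectrum and resolvent of an unbounded operator -/

section resolvent

variable {E : Type*} [NormedAddCommGroup E] [NormedSpace ℂ E]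

/-- The bounded, everywhere defined operator `R` is the two-sided inverse of `z - A`. -/
def IsResolventAt (A : E →ₗ.[ℂ] E) (z : ℂ) (R : E →L[ℂ] E) : Prop :=
  (∀ f : E, ∃ h : R f ∈ A.domain, z • R f - A ⟨R f, h⟩ = f) ∧
    ∀ v : A.domain, R (z • (v : E) - A v) = v

/-- The spectrum: the `z` for which `z - A` has no bounded, everywhere defined inverse. -/
def unboundedSpectrum (A : E →ₗ.[ℂ] E) : Set ℂ :=
  {z | ¬ ∃ R : E →L[ℂ] E, IsResolventAt A z R}

open scoped Classical in
/-- The resolvent `(z - A)⁻¹` for `z` outside the spectrum (and `0` on the spectrum). -/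
def unboundedResolvent (A : E →ₗ.[ℂ] E) (z : ℂ) : E →L[ℂ] E :=
  if h : ∃ R : E →L[ℂ] E, IsResolventAt A z R then h.choose else 0

end resolvent

end StVenant

end

open MeasureTheory

noncomputable section

namespace StVenant

/-! ### Smooth periodic coefficients -/

/-! Write D = ∂ₓ + iξ, a = ν τb⁻², m = a⁻¹, and let (τ, u) solve (z - L_ξ)(τ, u) = (f₁, f₂). The
good unknown is v = α τ + a D u. The first equation then reads z τ - c D τ + m α τ = f₁ + m v, a
transport equation forced by v. Computing D(a D v + lower-order terms) and using both equations,
every term carrying a factor z cancels except z v, so v solves a uniformly parabolic equation with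
sources of order zero in (τ, u, f₁, f₂).

Testing that equation with v and using both the real part (Re z ≥ -1) and the modulus gives D v =
O(1) and v = O(|z|^(-1/2)) relative to the sources. Differentiating the equation gives the same at
every Sobolev order.

The damping m α may change sign, as no slope condition holds. The weight b = τb⁻² corrects it: b τ
satisfies a transport equation with damping m α + c b'/b = 1/(ν F² τb), by ub' = -c τb'. This is
bounded below, so τ is controlled by f₁ and v for Re z slightly negative. Then z u = D v + c D u +
(f₂ - e₁ τ - e₂ u), with D u = m (v - α τ), makes u of size 1/|z|. Both bounds have the form C‖f‖ +
A/2 for |z| large, where A is an a priori bound on the solution; taking A to be the actual norm, A/2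
is absorbed (`resolvent_sob`). D is skew-adjoint for every ξ and the Leibniz constants do not see ξ,
so everything is uniform in ξ.

Existence: the resolvent equation is a first-order system of three equations (c ≠ 0 and a is
invertible), and 1 + D has a compact inverse on L². The Fredholm alternative reduces solvability to
uniqueness, which is the estimate at order zero; the equations then give regularity. Two facts about
the wave enter: c ≠ 0 and smoothness of the profile. -/

/-- The algebra of smooth `Ξ`-periodic complex functions, as a subalgebra of all functions. -/
def coefSubalgebra (Ξ : ℝ) : Subalgebra ℂ (ℝ → ℂ) where
  carrier := {a | ContDiff ℝ (⊤ : ℕ∞) a ∧ Function.Periodic a Ξ}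
  mul_mem' ha hb := ⟨ha.1.mul hb.1, ha.2.mul hb.2⟩
  add_mem' ha hb := ⟨ha.1.add hb.1, ha.2.add hb.2⟩
  algebraMap_mem' _ := ⟨contDiff_const, fun _ => rfl⟩

/-- Smooth `Ξ`-periodic complex functions. -/
def Coef (Ξ : ℝ) : Type := coefSubalgebra Ξ

namespace Coef

variable {Ξ : ℝ}

instance : CommRing (Coef Ξ) := inferInstanceAs (CommRing (coefSubalgebra Ξ))

instance : Algebra ℂ (Coef Ξ) := inferInstanceAs (Algebra ℂ (coefSubalgebra Ξ))

instance : FunLike (Coef Ξ) ℝ ℂ := ⟨fun a => a.1, Subtype.val_injective⟩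

@[ext] lemma ext {a b : Coef Ξ} (h : ∀ x, a x = b x) : a = b := DFunLike.ext _ _ h

@[simp] lemma add_apply (a b : Coef Ξ) (x : ℝ) : (a + b) x = a x + b x := rfl

@[simp] lemma mul_apply (a b : Coef Ξ) (x : ℝ) : (a * b) x = a x * b x := rfl

@[simp] lemma one_apply (x : ℝ) : (1 : Coef Ξ) x = 1 := rfl

@[simp] lemma zero_apply (x : ℝ) : (0 : Coef Ξ) x = 0 := rfl

@[simp] lemma smul_apply (r : ℂ) (a : Coef Ξ) (x : ℝ) : (r • a) x = r * a x := rfl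

lemma smooth (a : Coef Ξ) : ContDiff ℝ (⊤ : ℕ∞) (a : ℝ → ℂ) := a.2.1

lemma periodic (a : Coef Ξ) : Function.Periodic (a : ℝ → ℂ) Ξ := a.2.2

lemma continuous (a : Coef Ξ) : Continuous (a : ℝ → ℂ) := a.smooth.continuous

/-- The derivative of a coefficient. -/
def der (a : Coef Ξ) : Coef Ξ :=
  ⟨deriv a, (contDiff_infty_iff_deriv.1 a.smooth).2, fun x => by
    have h : (a : ℝ → ℂ) = fun y => (a : ℝ → ℂ) (y + Ξ) := funext fun y => (a.periodic y).symm
    conv_rhs => rw [h]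
    rw [deriv_comp_add_const]⟩

lemma hasDerivAt (a : Coef Ξ) (x : ℝ) : HasDerivAt (a : ℝ → ℂ) ((der a : ℝ → ℂ) x) x :=
  ((a.smooth.differentiable (by simp)) x).hasDerivAt

/-- The complex conjugate of a coefficient. -/
def cnj (a : Coef Ξ) : Coef Ξ :=
  ⟨fun x => (starRingEnd ℂ) ((a : ℝ → ℂ) x), (Complex.conjCLE.contDiff (n := (⊤ : ℕ∞))).comp a.smooth,
    fun x => congrArg _ (a.periodic x)⟩

lemma cnj_apply (a : Coef Ξ) (x : ℝ) :
    (cnj a : ℝ → ℂ) x = (starRingEnd ℂ) ((a : ℝ → ℂ) x) := rfl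

lemma der_cnj (a : Coef Ξ) (x : ℝ) :
    (der (cnj a) : ℝ → ℂ) x = (starRingEnd ℂ) ((der a : ℝ → ℂ) x) :=
  ((hasDerivAt (cnj a) x).unique (a.hasDerivAt x).star)

/-! ### Multiplication by coefficients on L²(0, Ξ) -/

lemma bounded (a : Coef Ξ) :
    ∃ C, 0 ≤ C ∧ ∀ᵐ x ∂periodMeasure Ξ, ‖(a : ℝ → ℂ) x‖ ≤ C := by
  obtain ⟨M, hM⟩ := (isCompact_Icc (a := (0 : ℝ)) (b := Ξ)).exists_bound_of_continuousOn
    a.continuous.continuousOn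
  refine ⟨|M|, abs_nonneg _, ?_⟩
  filter_upwards [ae_restrict_mem measurableSet_Ioc] with x hx
  exact (hM x ⟨hx.1.le, hx.2⟩).trans (le_abs_self M)

lemma memLp_mul (a : Coef Ξ) {f : ℝ → ℂ} (hf : MemLp f 2 (periodMeasure Ξ)) :
    MemLp (fun x => (a : ℝ → ℂ) x * f x) 2 (periodMeasure Ξ) := by
  obtain ⟨C, -, hC⟩ := a.bounded
  exact hf.of_le_mul (c := C) (a.continuous.aestronglyMeasurable.mul hf.1)
    (hC.mono fun x hx => by rw [norm_mul]; gcongr)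

instance : SMul (Coef Ξ) (L2Per Ξ) := ⟨fun a f => (a.memLp_mul (Lp.memLp f)).toLp _⟩

lemma coeFn_smul (a : Coef Ξ) (f : L2Per Ξ) :
    (a • f : L2Per Ξ) =ᵐ[periodMeasure Ξ] fun x => (a : ℝ → ℂ) x * f x :=
  MemLp.coeFn_toLp _

/-- With this structure the almost-everywhere identities between terms of the linearized equations
become purely algebraic and can be settled by `module`. -/
instance : Module (Coef Ξ) (L2Per Ξ) where
  one_smul f := by
    ext1; filter_upwards [coeFn_smul 1 f] with x h; rw [h]; simp
  mul_smul a b f := by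
    ext1
    filter_upwards [coeFn_smul (a * b) f, coeFn_smul a (b • f), coeFn_smul b f] with x h h' h''
    rw [h, h', h'']; simp [mul_assoc]
  smul_zero a := by
    ext1
    filter_upwards [coeFn_smul a 0, Lp.coeFn_zero ℂ 2 (periodMeasure Ξ)] with x h h'
    rw [h, h']; simp
  smul_add a f g := by
    ext1
    filter_upwards [coeFn_smul a (f + g), coeFn_smul a f, coeFn_smul a g,
      Lp.coeFn_add f g, Lp.coeFn_add (a • f) (a • g)] with x h h1 h2 h3 h4
    rw [h, h4, Pi.add_apply, h1, h2, h3, Pi.add_apply, mul_add]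
  add_smul a b f := by
    ext1
    filter_upwards [coeFn_smul (a + b) f, coeFn_smul a f, coeFn_smul b f,
      Lp.coeFn_add (a • f) (b • f)] with x h h1 h2 h4
    rw [h, h4, Pi.add_apply, h1, h2]; simp [add_mul]
  zero_smul f := by
    ext1
    filter_upwards [coeFn_smul 0 f, Lp.coeFn_zero ℂ 2 (periodMeasure Ξ)] with x h h'
    rw [h, h']; simp

instance : IsScalarTower ℂ (Coef Ξ) (L2Per Ξ) := ⟨fun r a f => by
  ext1
  filter_upwards [coeFn_smul (r • a) f, coeFn_smul a f, Lp.coeFn_smul r (a • f)] with x h h1 h2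
  rw [h, h2, Pi.smul_apply, h1]; simp [mul_assoc]⟩

instance : SMulCommClass ℂ (Coef Ξ) (L2Per Ξ) := IsScalarTower.to_smulCommClass

lemma exists_norm_smul_le (a : Coef Ξ) : ∃ C, 0 ≤ C ∧ ∀ f : L2Per Ξ, ‖a • f‖ ≤ C * ‖f‖ := by
  obtain ⟨C, hC0, hC⟩ := a.bounded
  refine ⟨C, hC0, fun f => Lp.norm_le_mul_norm_of_ae_le_mul ?_⟩
  filter_upwards [hC, coeFn_smul a f] with x h h'
  rw [h', norm_mul]; gcongr

/-- Multiplication by a coefficient, as a bounded operator. -/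
def mulL (a : Coef Ξ) : L2Per Ξ →L[ℂ] L2Per Ξ :=
  LinearMap.mkContinuousOfExistsBound
    { toFun := fun f => a • f
      map_add' := smul_add a
      map_smul' := fun r f => smul_comm a r f }
    (let ⟨C, _, hC⟩ := a.exists_norm_smul_le; ⟨C, hC⟩)

/-- Coercivity, used both for the viscosity and for the transport damping. -/
lemma le_re_inner_smul {a : Coef Ξ} {r : ℝ} (h : ∀ x, r ≤ ((a : ℝ → ℂ) x).re) (f : L2Per Ξ) :
    r * ‖f‖ ^ 2 ≤ (inner ℂ f (a • f)).re := by
  have h1 : ((r : ℂ) * inner ℂ f f).re = r * ‖f‖ ^ 2 := by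
    rw [inner_self_eq_norm_sq_to_K]; simp [← Complex.ofReal_pow]
  rw [← h1, L2.inner_def, L2.inner_def, ← integral_const_mul]
  have i1 : Integrable (fun x => (r : ℂ) * inner ℂ (f x) (f x)) (periodMeasure Ξ) :=
    (L2.integrable_inner f f).const_mul _
  have i2 := L2.integrable_inner (𝕜 := ℂ) f (a • f)
  have e1 := integral_re i1
  have e2 := integral_re i2
  simp only [RCLike.re_to_complex] at e1 e2
  rw [← e1, ← e2]
  refine integral_mono_ae i1.re i2.re ?_
  filter_upwards [coeFn_smul a f] with x hx
  simp only [RCLike.inner_apply, hx]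
  have e : f x * (starRingEnd ℂ) (f x) = ((‖f x‖ ^ 2 : ℝ) : ℂ) := by
    rw [Complex.mul_conj, Complex.normSq_eq_norm_sq]
  rw [mul_assoc, e, Complex.re_mul_ofReal, Complex.re_mul_ofReal, Complex.ofReal_re]
  exact mul_le_mul_of_nonneg_right (h x) (by positivity)

/-- A coefficient as an element of `L²(0, Ξ)`. -/
def toL2 (a : Coef Ξ) : L2Per Ξ :=
  (by simpa using a.memLp_mul (memLp_const (1 : ℂ)) :
    MemLp (a : ℝ → ℂ) 2 (periodMeasure Ξ)).toLp _

lemma coeFn_toL2 (a : Coef Ξ) : toL2 a =ᵐ[periodMeasure Ξ] (a : ℝ → ℂ) := MemLp.coeFn_toLp _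

lemma inner_toL2 (a : Coef Ξ) (f : L2Per Ξ) :
    inner ℂ (toL2 a) f = ∫ x, f x * (cnj a : ℝ → ℂ) x ∂periodMeasure Ξ := by
  rw [L2.inner_def]
  refine integral_congr_ae ?_
  filter_upwards [coeFn_toL2 a] with x hx
  rw [hx, RCLike.inner_apply]; rfl

lemma toL2_smul (r : ℂ) (a : Coef Ξ) : toL2 (r • a) = r • toL2 a := by
  ext1
  filter_upwards [coeFn_toL2 (r • a), coeFn_toL2 a, Lp.coeFn_smul r (toL2 a)] with x h h1 h2
  rw [h, h2, Pi.smul_apply, h1]; rfl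

end Coef

/-! ### Weak derivatives in `L²(0, Ξ)` -/

/-- `g = (∂ₓ + i ξ) f` weakly, in `L²(0, Ξ)`. -/
def BD {Ξ : ℝ} (ξ : ℝ) (f g : L2Per Ξ) : Prop := HasWeakBlochDeriv Ξ ξ f g

namespace BD

variable {Ξ ξ : ℝ} {f g f' g' : L2Per Ξ}

lemma add (h : BD ξ f g) (h' : BD ξ f' g') : BD ξ (f + f') (g + g') :=
  (HasWeakBlochDeriv.add h h').congr (Lp.coeFn_add _ _).symm (Lp.coeFn_add _ _).symm

lemma smul (r : ℂ) (h : BD ξ f g) : BD ξ (r • f) (r • g) :=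
  (HasWeakBlochDeriv.smul r h).congr (Lp.coeFn_smul _ _).symm (Lp.coeFn_smul _ _).symm

lemma neg (h : BD ξ f g) : BD ξ (-f) (-g) := by simpa using h.smul (-1)

lemma sub (h : BD ξ f g) (h' : BD ξ f' g') : BD ξ (f - f') (g - g') := by
  simpa [sub_eq_add_neg] using h.add h'.neg

lemma unique (h : BD ξ f g) (h' : BD ξ f g') : g = g' := by
  have := h.sub h'
  rw [sub_self] at this
  have := HasWeakBlochDeriv.eq_zero this (Lp.coeFn_zero _ _ _)
  exact sub_eq_zero.1 (Lp.ext (this.trans (Lp.coeFn_zero _ _ _).symm))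

/-- Leibniz rule: the product of `a` with a test function is again a test function. -/
lemma coef_smul (a : Coef Ξ) (h : BD ξ f g) : BD ξ (a • f) (a.der • f + a • g) := by
  refine ⟨Lp.memLp _, Lp.memLp _, fun φ hφ hp => ?_⟩
  have key := h.2.2 (fun x => (a : ℝ → ℂ) x * φ x) (a.smooth.mul hφ) (a.periodic.mul hp)
  have hd : ∀ x, deriv (fun x => (a : ℝ → ℂ) x * φ x) x
      = (a.der : ℝ → ℂ) x * φ x + (a : ℝ → ℂ) x * deriv φ x := fun x =>
    ((a.hasDerivAt x).mul ((hφ.differentiable (by simp)) x).hasDerivAt).deriv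
  simp only [hd] at key
  have i1 := integrable_mul_of_continuous (Lp.memLp (a.der • f)) hφ.continuous
  have i2 := integrable_mul_of_continuous (Lp.memLp (a • g)) hφ.continuous
  have i3 := integrable_mul_of_continuous (Lp.memLp (a • f)) (continuous_test (ξ := ξ) hφ)
  calc _ = ∫ x, ((a.der • f : L2Per Ξ) x * φ x + (a • g : L2Per Ξ) x * φ x) ∂periodMeasure Ξ := by
        refine integral_congr_ae ?_
        filter_upwards [Lp.coeFn_add (a.der • f) (a • g)] with x hx
        rw [hx, Pi.add_apply, add_mul]
    _ = _ := by
        rw [integral_add i1 i2]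
        have : ∫ x, (a • g : L2Per Ξ) x * φ x ∂periodMeasure Ξ
            = ∫ x, g x * ((a : ℝ → ℂ) x * φ x) ∂periodMeasure Ξ := by
          refine integral_congr_ae ?_
          filter_upwards [Coef.coeFn_smul a g] with x hx
          rw [hx]; ring
        rw [this, key, ← eq_sub_iff_add_eq', ← integral_sub i3 i1]
        refine integral_congr_ae ?_
        filter_upwards [Coef.coeFn_smul a f, Coef.coeFn_smul a.der f] with x hx hx'
        rw [hx, hx']; ring

lemma of_eq (h : BD ξ f g) (hf : f = f') (hg : g = g') : BD ξ f' g' := hf ▸ hg ▸ h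

end BD

/-- Conjugating the test function turns the bilinear pairing of the weak formulation into the
Hermitian one, so that Hilbert space tools apply. -/
lemma bd_iff {Ξ ξ : ℝ} {f g : L2Per Ξ} : BD ξ f g ↔ ∀ a : Coef Ξ,
    inner ℂ a.toL2 g = - inner ℂ (a.der + (Complex.I * ξ) • a).toL2 f := by
  have key : ∀ a : Coef Ξ, - inner ℂ (a.der + (Complex.I * ξ) • a).toL2 f
      = ∫ x, f x * (-deriv (a.cnj : ℝ → ℂ) x + Complex.I * (ξ : ℂ) * (a.cnj : ℝ → ℂ) x)
        ∂periodMeasure Ξ := by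
    intro a
    rw [Coef.inner_toL2, ← integral_neg]
    congr 1; ext x
    have : deriv (a.cnj : ℝ → ℂ) x = (starRingEnd ℂ) ((a.der : ℝ → ℂ) x) := Coef.der_cnj a x
    rw [this, Coef.cnj_apply, Coef.cnj_apply]
    simp; ring
  constructor
  · intro h a
    rw [key, Coef.inner_toL2]
    exact h.2.2 a.cnj a.cnj.smooth a.cnj.periodic
  · intro h
    refine ⟨Lp.memLp _, Lp.memLp _, fun φ hφ hp => ?_⟩
    have := h (Coef.cnj ⟨φ, hφ, hp⟩)
    rw [key, Coef.inner_toL2] at this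
    have e : (Coef.cnj ⟨φ, hφ, hp⟩ : Coef Ξ).cnj = ⟨φ, hφ, hp⟩ := by
      ext x; exact Complex.conj_conj _
    rwa [e] at this

/-! ### Diagonal operators in a Hilbert basis -/

section diagonal

variable {ι E : Type*} [NormedAddCommGroup E] [InnerProductSpace ℂ E]

lemma HilbertBasis.exists_diagonal (b : HilbertBasis ι ℂ E) (μ : ι → ℂ) {C : ℝ} (hC : 0 ≤ C)
    (hμ : ∀ i, ‖μ i‖ ≤ C) :
    ∃ T : E →L[ℂ] E, (∀ f i, inner ℂ (b i) (T f) = μ i * inner ℂ (b i) f) ∧ ‖T‖ ≤ C := by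
  have hm : ∀ f : E, Memℓp (fun i => μ i * b.repr f i) 2 := fun f => by
    refine memℓp_gen ?_
    have hs := (lp.memℓp (b.repr f)).summable (by norm_num)
    refine (hs.mul_left (C ^ 2)).of_nonneg_of_le (fun i => by positivity) fun i => ?_
    simp only [ENNReal.toReal_ofNat, Real.rpow_two, norm_mul, mul_pow]
    gcongr
    exact hμ i
  let T₀ : E →ₗ[ℂ] E :=
    { toFun := fun f => b.repr.symm ⟨_, hm f⟩
      map_add' := fun f g => by
        rw [← map_add]; congr 1; ext i; simp [mul_add]; rfl
      map_smul' := fun r f => by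
        rw [RingHom.id_apply, ← map_smul]; congr 1; ext i; simp [mul_left_comm] }
  have hb : ∀ f, ‖T₀ f‖ ≤ C * ‖f‖ := fun f => by
    change ‖b.repr.symm ⟨_, hm f⟩‖ ≤ _
    rw [LinearIsometryEquiv.norm_map, ← b.repr.norm_map f]
    refine lp.norm_le_of_forall_sum_le (by norm_num) (by positivity) fun s => ?_
    have h2 := lp.sum_rpow_le_norm_rpow (p := 2) (by norm_num) (b.repr f) s
    simp only [ENNReal.toReal_ofNat, Real.rpow_two] at h2 ⊢
    calc _ ≤ ∑ i ∈ s, C ^ 2 * ‖b.repr f i‖ ^ 2 := by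
          refine Finset.sum_le_sum fun i _ => ?_
          rw [norm_mul, mul_pow]; gcongr; exact hμ i
      _ ≤ _ := by rw [← Finset.mul_sum, mul_pow]; gcongr
  refine ⟨T₀.mkContinuous C hb, fun f i => ?_, T₀.mkContinuous_norm_le hC hb⟩
  rw [← b.repr_apply_apply, ← b.repr_apply_apply]
  change b.repr (b.repr.symm ⟨_, hm f⟩) i = _
  rw [LinearIsometryEquiv.apply_symm_apply]

lemma HilbertBasis.ext_inner (b : HilbertBasis ι ℂ E) {f g : E}
    (h : ∀ i, inner ℂ (b i) f = inner ℂ (b i) g) : f = g := by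
  refine b.repr.injective (lp.ext (funext fun i => ?_))
  rw [b.repr_apply_apply, b.repr_apply_apply, h i]

lemma isCompactOperator_inner_smul (v w : E) :
    IsCompactOperator fun f : E => inner ℂ v f • w := by
  have h : IsCompactOperator fun f : E => inner ℂ v f :=
    (isCompactOperator_id (E := ℂ)).comp_clm (innerSL ℂ v)
  exact h.clm_comp (ContinuousLinearMap.toSpanSingleton ℂ w)

variable [CompleteSpace E]

/-- A diagonal operator with entries tending to zero is a norm limit of finite-rank truncations. -/
lemma HilbertBasis.isCompactOperator_diagonal (b : HilbertBasis ι ℂ E) {μ : ι → ℂ}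
    (hμ : Filter.Tendsto μ Filter.cofinite (nhds 0)) (T : E →L[ℂ] E)
    (hT : ∀ f i, inner ℂ (b i) (T f) = μ i * inner ℂ (b i) f) : IsCompactOperator T := by
  classical
  have hmem : T ∈ closure {S : E →L[ℂ] E | IsCompactOperator S} := by
    refine Metric.mem_closure_iff.2 fun ε hε => ?_
    have hfin : {i | ¬ ‖μ i‖ < ε / 2}.Finite := by
      have := hμ.norm.eventually_lt_const (u := ε / 2) (by simpa using half_pos hε)
      exact this
    -- `S` keeps only the small entries: `T - S` has finite rank and lies within ε/2 of `T`.
    obtain ⟨S, hS, hSn⟩ := HilbertBasis.exists_diagonal b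
      (fun i => if ‖μ i‖ < ε / 2 then μ i else 0) (half_pos hε).le
      (fun i => by split_ifs with h; exacts [h.le, by simpa using (half_pos hε).le])
    refine ⟨T - S, ?_, ?_⟩
    · have e : (⇑(T - S) : E → E) = fun f => ∑ i ∈ hfin.toFinset, inner ℂ (b i) f • (μ i • b i) := by
        ext f
        refine HilbertBasis.ext_inner b fun j => ?_
        rw [inner_sum]
        simp only [inner_smul_right, _root_.sub_apply, inner_sub_right, hT, hS,
          orthonormal_iff_ite.1 b.orthonormal]
        by_cases h : ‖μ j‖ < ε / 2
        · rw [if_pos h, sub_self, Finset.sum_eq_zero]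
          intro i hi
          rw [if_neg, mul_zero, mul_zero]
          rintro rfl
          exact (hfin.mem_toFinset.1 hi) h
        · rw [if_neg h, Finset.sum_eq_single_of_mem j (hfin.mem_toFinset.2 h)]
          · simp [mul_comm]
          · intro i _ hij
            rw [if_neg hij.symm, mul_zero, mul_zero]
      change IsCompactOperator (⇑(T - S))
      rw [e]
      have : ∀ s : Finset ι,
          IsCompactOperator fun f : E => ∑ i ∈ s, inner ℂ (b i) f • (μ i • b i) := by
        intro s
        induction s using Finset.induction_on with
        | empty => simp only [Finset.sum_empty]; exact isCompactOperator_zero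
        | insert i s hi ih =>
          simp only [Finset.sum_insert hi]
          exact (isCompactOperator_inner_smul _ _).add ih
      exact this _
    · rw [dist_eq_norm, sub_sub_cancel]
      exact hSn.trans_lt (half_lt_self hε)
  exact isClosed_setOfPred_isCompactOperator.closure_subset hmem

end diagonal

/-! ### The Fourier basis of `L²(0, Ξ)` -/

section fourier

variable {Ξ : ℝ} (hΞ : 0 < Ξ)

/-- The normalized Fourier exponentials. -/
def expCoef (Ξ : ℝ) (n : ℤ) : Coef Ξ :=
  ⟨fun x => ((√Ξ)⁻¹ : ℝ) * Complex.exp (2 * Real.pi * Complex.I * n * x / Ξ), by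
    constructor
    · have : ContDiff ℝ (⊤ : ℕ∞) fun x : ℝ => (x : ℂ) := Complex.ofRealCLM.contDiff
      fun_prop
    · intro x
      dsimp only
      rw [← fourier_coe_apply, ← fourier_coe_apply, AddCircle.coe_add_period]⟩

lemma expCoef_apply (n : ℤ) (x : ℝ) :
    expCoef Ξ n x = ((√Ξ)⁻¹ : ℝ) * Complex.exp (2 * Real.pi * Complex.I * n * x / Ξ) := rfl

lemma der_expCoef (n : ℤ) :
    (expCoef Ξ n).der = (2 * Real.pi * Complex.I * n / Ξ) • expCoef Ξ n := by
  ext x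
  refine ((expCoef Ξ n).hasDerivAt x).unique ?_
  have h : HasDerivAt (fun y : ℝ => 2 * Real.pi * Complex.I * n * (y : ℂ) / Ξ)
      (2 * Real.pi * Complex.I * n / Ξ) x := by
    simpa using ((Complex.ofRealCLM.hasDerivAt (x := x)).const_mul
      (2 * Real.pi * Complex.I * n : ℂ)).div_const (Ξ : ℂ)
  refine (h.cexp.const_mul (((√Ξ)⁻¹ : ℝ) : ℂ)).congr_deriv ?_
  rw [Coef.smul_apply, expCoef_apply]; ring

lemma cnj_expCoef_mul (hΞ : 0 < Ξ) (m n : ℤ) (x : ℝ) : expCoef Ξ n x * (expCoef Ξ m).cnj x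
    = (Ξ⁻¹ : ℝ) * Complex.exp ((2 * Real.pi * Complex.I * (n - m : ℤ) / Ξ) * x) := by
  have h : ((√Ξ)⁻¹ : ℝ) * ((√Ξ)⁻¹ : ℝ) = Ξ⁻¹ := by
    rw [← mul_inv, Real.mul_self_sqrt hΞ.le]
  rw [Coef.cnj_apply, expCoef_apply, expCoef_apply, map_mul, Complex.conj_ofReal,
    ← Complex.exp_conj, mul_mul_mul_comm, ← Complex.ofReal_mul, h, ← Complex.exp_add]
  congr 2
  simp only [Int.cast_sub, map_div₀, map_mul, map_ofNat, Complex.conj_ofReal, Complex.conj_I,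
    map_intCast]
  ring

include hΞ in
lemma orthonormal_expCoef : Orthonormal ℂ fun n : ℤ => (expCoef Ξ n).toL2 := by
  rw [orthonormal_iff_ite]
  intro m n
  rw [Coef.inner_toL2]
  have : ∫ x, (expCoef Ξ n).toL2 x * (expCoef Ξ m).cnj x ∂periodMeasure Ξ
      = ∫ x in (0 : ℝ)..Ξ,
        (Ξ⁻¹ : ℝ) * Complex.exp ((2 * Real.pi * Complex.I * (n - m : ℤ) / Ξ) * x) := by
    rw [intervalIntegral.integral_of_le hΞ.le]
    refine integral_congr_ae ?_
    filter_upwards [Coef.coeFn_toL2 (expCoef Ξ n)] with x hx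
    rw [hx, cnj_expCoef_mul hΞ]
  have hΞ' : (Ξ : ℂ) ≠ 0 := by exact_mod_cast hΞ.ne'
  rw [this, intervalIntegral.integral_const_mul]
  split_ifs with h
  · subst h; simp [hΞ']
  · have hnm : ((n - m : ℤ) : ℂ) ≠ 0 := by exact_mod_cast sub_ne_zero.2 (Ne.symm h)
    rw [integral_exp_mul_complex (by
      have : (Real.pi : ℂ) ≠ 0 := by exact_mod_cast Real.pi_ne_zero
      simp only [ne_eq, div_eq_zero_iff, mul_eq_zero, not_or]
      exact ⟨⟨⟨⟨by norm_num, this⟩, Complex.I_ne_zero⟩, hnm⟩, hΞ'⟩)]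
    rw [div_mul_cancel₀ _ hΞ', mul_comm _ ((n - m : ℤ) : ℂ), Complex.exp_int_mul_two_pi_mul_I]
    simp

/-- The Fourier basis of `L²(0, Ξ)`. -/
def expBasis : HilbertBasis ℤ ℂ (L2Per Ξ) :=
  HilbertBasis.mkOfOrthogonalEqBot (orthonormal_expCoef hΞ) (by
    rw [Submodule.eq_bot_iff]
    intro f hf
    have hf' : ∀ n, inner ℂ (expCoef Ξ n).toL2 f = 0 := fun n =>
      (Submodule.mem_orthogonal _ _).1 hf _ (Submodule.subset_span ⟨n, rfl⟩)
    have hc : ∀ n : ℤ, fourierCoeffOn hΞ f n = 0 := by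
      intro n
      have hn := hf' n
      rw [Coef.inner_toL2] at hn
      rw [fourierCoeffOn_eq_integral, intervalIntegral.integral_of_le hΞ.le]
      have e : ∀ x : ℝ, fourier (-n) (x : AddCircle (Ξ - 0)) • f x
          = (√Ξ : ℂ) * (f x * (expCoef Ξ n).cnj x) := by
        intro x
        have h0 : (√Ξ : ℂ) ≠ 0 := by exact_mod_cast (Real.sqrt_pos.2 hΞ).ne'
        rw [fourier_neg, fourier_coe_apply, Coef.cnj_apply, expCoef_apply, map_mul,
          Complex.conj_ofReal, smul_eq_mul, sub_zero, Complex.ofReal_inv]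
        field_simp
      simp only [e]
      rw [integral_const_mul, hn, mul_zero, smul_zero]
    have hs := hasSum_sq_fourierCoeffOn hΞ (Lp.memLp f)
    simp only [hc, norm_zero, ne_eq, OfNat.ofNat_ne_zero, not_false_eq_true, zero_pow] at hs
    have h2 := hs.unique hasSum_zero
    rw [smul_eq_zero, sub_zero] at h2
    have h3 := h2.resolve_left (inv_ne_zero hΞ.ne')
    rw [intervalIntegral.integral_of_le hΞ.le,
      integral_eq_zero_iff_of_nonneg (fun x => by positivity)
        ((memLp_two_iff_integrable_sq_norm (Lp.memLp f).1).1 (Lp.memLp f))] at h3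
    refine Lp.ext (Filter.EventuallyEq.trans ?_ (Lp.coeFn_zero _ _ _).symm)
    exact h3.mono fun x hx => by simpa using hx)

lemma expBasis_apply (n : ℤ) : expBasis hΞ n = (expCoef Ξ n).toL2 := by
  rw [expBasis, HilbertBasis.coe_mkOfOrthogonalEqBot]

/-- The frequencies `2 π n / Ξ + ξ`. -/
def freq (Ξ ξ : ℝ) (n : ℤ) : ℝ := 2 * Real.pi * n / Ξ + ξ

variable {ξ : ℝ} {f g f' g' : L2Per Ξ}

lemma BD.inner_expBasis (h : BD ξ f g) (n : ℤ) :
    inner ℂ (expBasis hΞ n) g = Complex.I * freq Ξ ξ n * inner ℂ (expBasis hΞ n) f := by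
  rw [expBasis_apply, bd_iff.1 h, der_expCoef, ← add_smul, Coef.toL2_smul, inner_smul_left,
    ← neg_mul]
  congr 1
  simp only [freq, map_add, map_div₀, map_mul, map_ofNat, Complex.conj_ofReal, Complex.conj_I,
    map_intCast]
  push_cast
  ring

/-- By Parseval, since the multiplier `I * freq Ξ ξ n` is purely imaginary. -/
lemma inner_eq_neg_inner_of_freq
    (h : ∀ n, inner ℂ (expBasis hΞ n) g = Complex.I * freq Ξ ξ n * inner ℂ (expBasis hΞ n) f)
    (h' : ∀ n, inner ℂ (expBasis hΞ n) g' = Complex.I * freq Ξ ξ n * inner ℂ (expBasis hΞ n) f') :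
    inner ℂ g f' = - inner ℂ f g' := by
  rw [← (expBasis hΞ).tsum_inner_mul_inner g f', ← (expBasis hΞ).tsum_inner_mul_inner f g',
    ← tsum_neg]
  congr 1; ext n
  rw [h', ← inner_conj_symm g, h, ← inner_conj_symm f]
  simp only [map_mul, Complex.conj_I, Complex.conj_ofReal]
  ring

include hΞ in
/-- `∂ₓ + i ξ` is skew-adjoint. -/
lemma BD.inner_skew (h : BD ξ f g) (h' : BD ξ f' g') : inner ℂ g f' = - inner ℂ f g' :=
  inner_eq_neg_inner_of_freq hΞ (h.inner_expBasis hΞ) (h'.inner_expBasis hΞ)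

include hΞ in
lemma BD.re_inner_self (h : BD ξ f g) : (inner ℂ f g).re = 0 := by
  have := congrArg Complex.re (h.inner_skew hΞ h)
  rw [← inner_conj_symm, Complex.conj_re, Complex.neg_re] at this
  linarith

-- Classical integration by parts; the boundary terms cancel by periodicity.
include hΞ in
lemma Coef.bd_toL2 (a : Coef Ξ) : BD ξ a.toL2 (a.der + (Complex.I * ξ) • a).toL2 := by
  rw [bd_iff]
  intro b
  rw [Coef.inner_toL2, Coef.inner_toL2, ← integral_neg, ← sub_eq_zero, ← integral_sub
    (integrable_mul_of_continuous (Lp.memLp _) (Coef.continuous _))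
    (integrable_mul_of_continuous (Lp.memLp _) (Coef.continuous _)).fun_neg]
  have : ∀ᵐ x ∂periodMeasure Ξ, (a.der + (Complex.I * ξ) • a).toL2 x * b.cnj x
      - -(a.toL2 x * (b.der + (Complex.I * ξ) • b).cnj x) = (a * b.cnj).der x := by
    filter_upwards [Coef.coeFn_toL2 a, Coef.coeFn_toL2 (a.der + (Complex.I * ξ) • a)] with x h h'
    have hd : (a * b.cnj).der x = a.der x * b.cnj x + a x * b.cnj.der x :=
      ((a * b.cnj).hasDerivAt x).unique ((a.hasDerivAt x).mul (b.cnj.hasDerivAt x))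
    rw [h, h', hd, Coef.der_cnj]
    simp [Coef.cnj_apply]
    ring
  rw [integral_congr_ae this, ← intervalIntegral.integral_of_le hΞ.le,
    intervalIntegral.integral_eq_sub_of_hasDerivAt (fun x _ => (a * b.cnj).hasDerivAt x)
      ((Coef.continuous _).intervalIntegrable _ _)]
  have := (a * b.cnj).periodic 0
  rw [zero_add] at this
  rw [this, sub_self]

/-- Test functions have weak derivatives themselves, so Parseval against them recovers the weak
formulation from the Fourier coefficients. -/
lemma BD.of_inner_expBasis
    (h : ∀ n, inner ℂ (expBasis hΞ n) g = Complex.I * freq Ξ ξ n * inner ℂ (expBasis hΞ n) f) :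
    BD ξ f g := by
  rw [bd_iff]
  intro a
  have := inner_eq_neg_inner_of_freq hΞ ((a.bd_toL2 hΞ (ξ := ξ)).inner_expBasis hΞ) h
  rw [this, neg_neg]

include hΞ in
lemma tendsto_freq_inv :
    Filter.Tendsto (fun n => (1 + Complex.I * freq Ξ ξ n)⁻¹) Filter.cofinite (nhds 0) := by
  refine Filter.tendsto_inv₀_cobounded.comp (tendsto_norm_atTop_iff_cobounded.1 ?_)
  have h1 : Filter.Tendsto (fun n : ℤ => 2 * Real.pi / Ξ * ‖(n : ℝ)‖ + -|ξ|)
      Filter.cofinite Filter.atTop :=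
    Filter.tendsto_atTop_add_const_right _ _
      (((tendsto_norm_cocompact_atTop ).comp Int.tendsto_coe_cofinite).const_mul_atTop
        (by positivity))
  refine Filter.tendsto_atTop_mono (fun n => ?_) h1
  have h2 := Complex.abs_im_le_norm (1 + Complex.I * freq Ξ ξ n)
  simp only [Complex.add_im, Complex.one_im, Complex.mul_im, Complex.I_re, Complex.ofReal_im,
    Complex.I_im, Complex.ofReal_re, zero_mul, one_mul, zero_add] at h2
  refine le_trans ?_ h2
  have h3 := abs_sub_abs_le_abs_sub (2 * Real.pi * n / Ξ) (-ξ)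
  have e : 2 * Real.pi * n / Ξ = 2 * Real.pi / Ξ * n := by ring
  rw [sub_neg_eq_add, abs_neg, e, abs_mul,
    abs_of_pos (show 0 < 2 * Real.pi / Ξ by positivity)] at h3
  rw [freq, Real.norm_eq_abs, e]
  linarith

include hΞ in
/-- `1 + ∂ₓ + i ξ` has a compact inverse. -/
lemma exists_inverse_one_add (ξ : ℝ) : ∃ T : L2Per Ξ →L[ℂ] L2Per Ξ, IsCompactOperator T ∧
    ∀ g, BD ξ (T g) (g - T g) := by
  have hne : ∀ n, 1 + Complex.I * freq Ξ ξ n ≠ 0 := fun n h => by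
    have := congrArg Complex.re h; simp at this
  -- The symbol 1 + i freq has real part 1, so its inverse exists and is bounded by 1.
  obtain ⟨T, hT, -⟩ := HilbertBasis.exists_diagonal (expBasis hΞ)
    (fun n => (1 + Complex.I * freq Ξ ξ n)⁻¹) zero_le_one (fun n => by
      rw [norm_inv]
      refine inv_le_one_of_one_le₀ ?_
      simpa using Complex.abs_re_le_norm (1 + Complex.I * freq Ξ ξ n))
  refine ⟨T, HilbertBasis.isCompactOperator_diagonal _ (tendsto_freq_inv hΞ) T hT,
    fun g => BD.of_inner_expBasis hΞ fun n => ?_⟩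
  rw [inner_sub_right, hT]
  have := hne n
  field_simp
  ring

end fourier

/-! ### Sobolev bounds -/

/-- `f` has `n` weak derivatives in `L²(0, Ξ)`, and `f` and these are bounded by `A` in norm. -/
def Sob {Ξ : ℝ} (ξ : ℝ) : ℕ → L2Per Ξ → ℝ → Prop
  | 0, f, A => ‖f‖ ≤ A
  | n + 1, f, A => ‖f‖ ≤ A ∧ ∃ g, BD ξ f g ∧ Sob ξ n g A

namespace Sob

variable {Ξ ξ : ℝ} {n : ℕ} {f g : L2Per Ξ} {A B : ℝ}

lemma norm_le (h : Sob ξ n f A) : ‖f‖ ≤ A := by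
  cases n with
  | zero => exact h
  | succ n => exact h.1

lemma nonneg (h : Sob ξ n f A) : 0 ≤ A := (norm_nonneg _).trans h.norm_le

lemma mono (hAB : A ≤ B) (h : Sob ξ n f A) : Sob ξ n f B := by
  induction n generalizing f with
  | zero => exact le_trans h hAB
  | succ n ih =>
    obtain ⟨h1, g, h2, h3⟩ := h
    exact ⟨h1.trans hAB, g, h2, ih h3⟩

lemma of_succ (h : Sob ξ (n + 1) f A) : Sob ξ n f A := by
  induction n generalizing f with
  | zero => exact h.1
  | succ n ih =>
    obtain ⟨h1, g, h2, h3⟩ := h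
    exact ⟨h1, g, h2, ih h3⟩

lemma succ_of_bd (h : BD ξ f g) (hf : Sob ξ n f A) (hg : Sob ξ n g A) : Sob ξ (n + 1) f A :=
  ⟨hf.norm_le, g, h, hg⟩

lemma of_bd (h : BD ξ f g) (hf : Sob ξ (n + 1) f A) : Sob ξ n g A := by
  obtain ⟨-, g', h2, h3⟩ := hf
  rwa [h.unique h2]

lemma add (hf : Sob ξ n f A) (hg : Sob ξ n g B) : Sob ξ n (f + g) (A + B) := by
  induction n generalizing f g with
  | zero => exact (norm_add_le _ _).trans (add_le_add hf hg)
  | succ n ih =>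
    obtain ⟨h1, f', h2, h3⟩ := hf
    obtain ⟨k1, g', k2, k3⟩ := hg
    exact ⟨(norm_add_le _ _).trans (add_le_add h1 k1), _, h2.add k2, ih h3 k3⟩

lemma smul (r : ℂ) (hf : Sob ξ n f A) : Sob ξ n (r • f) (‖r‖ * A) := by
  have key : ∀ f : L2Per Ξ, ‖f‖ ≤ A → ‖r • f‖ ≤ ‖r‖ * A := fun f h => by
    rw [norm_smul]; gcongr
  induction n generalizing f with
  | zero => exact key f hf
  | succ n ih =>
    obtain ⟨h1, f', h2, h3⟩ := hf
    exact ⟨key f h1, _, h2.smul r, ih h3⟩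

lemma neg (hf : Sob ξ n f A) : Sob ξ n (-f) A := by simpa using hf.smul (-1)

lemma sub (hf : Sob ξ n f A) (hg : Sob ξ n g B) : Sob ξ n (f - g) (A + B) := by
  simpa [sub_eq_add_neg] using hf.add hg.neg

/-- Only `a` is differentiated in the Leibniz rule, and ξ does not appear in it; hence the constant
precedes ξ. -/
lemma exists_coef (n : ℕ) (a : Coef Ξ) : ∃ C, 0 ≤ C ∧ ∀ (ξ : ℝ) (f : L2Per Ξ) (A : ℝ),
    Sob ξ n f A → Sob ξ n (a • f) (C * A) := by
  induction n generalizing a with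
  | zero =>
    obtain ⟨C, hC, h⟩ := a.exists_norm_smul_le
    exact ⟨C, hC, fun ξ f A hf => (h f).trans (mul_le_mul_of_nonneg_left hf hC)⟩
  | succ n ih =>
    obtain ⟨C, hC, h⟩ := ih a
    obtain ⟨C', hC', h'⟩ := ih a.der
    refine ⟨C + C', by positivity, fun ξ f A hf => ?_⟩
    have hA := hf.nonneg
    obtain ⟨-, g, h2, h3⟩ := id hf
    refine succ_of_bd (h2.coef_smul a) ((h ξ f A hf.of_succ).mono ?_) ?_
    · nlinarith [mul_nonneg hC' hA]
    · exact ((h' ξ f A hf.of_succ).add (h ξ g A h3)).mono (by linarith)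

/-- A bound for the multiplication by `a` on `H^n`, uniform in `ξ`. -/
def mulBound (n : ℕ) (a : Coef Ξ) : ℝ := (exists_coef n a).choose

lemma mulBound_nonneg (n : ℕ) (a : Coef Ξ) : 0 ≤ mulBound n a := (exists_coef n a).choose_spec.1

lemma coef (a : Coef Ξ) (hf : Sob ξ n f A) : Sob ξ n (a • f) (mulBound n a * A) :=
  (exists_coef n a).choose_spec.2 ξ f A hf

end Sob

open Sob (mulBound mulBound_nonneg)

/-! ### Energy estimates -/

section energy

variable {Ξ : ℝ}

/-- Here x = ‖w‖, y = ‖D w‖, r = |z|. The two hypotheses are the real part and the modulus of the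
energy identity. The first bounds y by x and B; inserted in the second, it lets a large r absorb x.
-/
lemma real_energy_bound {a₀ : ℝ} (ha₀ : 0 < a₀) {c M P Q : ℝ} (hc : 0 ≤ c) (hM : 0 ≤ M)
    (hP : 0 ≤ P) (hQ : 0 ≤ Q) : ∃ C R : ℝ, 0 ≤ C ∧ 1 ≤ R ∧ ∀ r x y B : ℝ, R ≤ r →
      0 ≤ x → 0 ≤ y → 0 ≤ B →
      a₀ * y ^ 2 ≤ x ^ 2 + Q * x ^ 2 + x * B + P * (x * y) + y * B →
      r * x ^ 2 ≤ c * (x * y) + Q * x ^ 2 + x * B + M * y ^ 2 + P * (x * y) + y * B →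
      y ≤ C * B ∧ x ≤ C * B / √r := by
  set K := 2 * (2 + Q + P ^ 2 / a₀ + 1 + 1 / a₀) / a₀ with hK
  set N := (c + M + P + Q + 2) * (1 + K) with hN
  have hK0 : 0 ≤ K := by positivity
  have hN0 : 0 ≤ N := by positivity
  -- The threshold leaves at least half of r x² after absorbing N x²; the squared constant dominates
  -- both 2N (for x) and K(2N + 1) (for y).
  refine ⟨√((2 * N + 1) * (K + 1)), 2 * N + 1, by positivity, by linarith, ?_⟩
  intro r x y B hr hx hy hB h1 h2
  have hr0 : 0 < r := by linarith
  -- Young's inequality, spending a₀/4 of the coercive term on each of the two products containing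
  -- y.
  have hy2 : y ^ 2 ≤ K * (x ^ 2 + B ^ 2) := by
    rw [hK, div_mul_eq_mul_div, le_div_iff₀ ha₀]
    have e1 : P * (x * y) ≤ a₀ / 4 * y ^ 2 + P ^ 2 / a₀ * x ^ 2 := by
      have := sq_nonneg (a₀ / 2 * y - P * x)
      have e : a₀ / 4 * y ^ 2 + P ^ 2 / a₀ * x ^ 2 - P * (x * y)
        = (a₀ / 2 * y - P * x) ^ 2 / a₀ := by field_simp; ring
      have := div_nonneg this ha₀.le
      linarith
    have e2 : y * B ≤ a₀ / 4 * y ^ 2 + 1 / a₀ * B ^ 2 := by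
      have := sq_nonneg (a₀ / 2 * y - B)
      have e : a₀ / 4 * y ^ 2 + 1 / a₀ * B ^ 2 - y * B
        = (a₀ / 2 * y - B) ^ 2 / a₀ := by field_simp; ring
      have := div_nonneg this ha₀.le
      linarith
    have e3 : x * B ≤ x ^ 2 + B ^ 2 := by nlinarith [sq_nonneg (x - B)]
    have p1 : 0 ≤ 1 / a₀ * x ^ 2 := by positivity
    have p2 : 0 ≤ P ^ 2 / a₀ * B ^ 2 := by positivity
    have p3 : 0 ≤ Q * B ^ 2 := by positivity
    nlinarith [sq_nonneg x, sq_nonneg B]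
  have hx2 : r * x ^ 2 ≤ 2 * N * B ^ 2 := by
    have e0 : x * y ≤ x ^ 2 + y ^ 2 := by nlinarith [sq_nonneg (x - y)]
    have e1 : c * (x * y) ≤ c * (x ^ 2 + y ^ 2) := by gcongr
    have e2 : P * (x * y) ≤ P * (x ^ 2 + y ^ 2) := by gcongr
    have e3 : x * B ≤ x ^ 2 + B ^ 2 := by nlinarith [sq_nonneg (x - B)]
    have e4 : y * B ≤ y ^ 2 + B ^ 2 := by nlinarith [sq_nonneg (y - B)]
    have e5 : r * x ^ 2 ≤ (c + M + P + Q + 2) * (x ^ 2 + y ^ 2 + B ^ 2) := by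
      have p1 : 0 ≤ (c + M + P + Q) * B ^ 2 := by positivity
      have p2 : 0 ≤ M * x ^ 2 := by positivity
      have p3 : 0 ≤ Q * y ^ 2 := by positivity
      nlinarith [sq_nonneg x, sq_nonneg y]
    have e6 : r * x ^ 2 ≤ N * (x ^ 2 + B ^ 2) := by
      refine e5.trans ?_
      rw [hN, mul_assoc]
      gcongr
      linarith
    have e7 : (2 * N) * x ^ 2 ≤ r * x ^ 2 := by gcongr; linarith
    linarith
  constructor
  · rw [← abs_of_nonneg hy, ← abs_of_nonneg hB]
    refine abs_le_of_sq_le_sq' ?_ (by positivity) |> abs_le.2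
    rw [mul_pow, Real.sq_sqrt (by positivity), sq_abs]
    have : x ^ 2 ≤ 2 * N * B ^ 2 := by
      refine le_trans ?_ hx2
      nlinarith [sq_nonneg x]
    have : K * (x ^ 2 + B ^ 2) ≤ K * (2 * N * B ^ 2 + B ^ 2) := by gcongr
    have : 0 ≤ (2 * N + 1) * B ^ 2 := by positivity
    linarith
  · rw [le_div_iff₀ (Real.sqrt_pos.2 hr0)]
    refine (abs_le_of_sq_le_sq' ?_ (by positivity)).2
    rw [mul_pow, mul_pow, Real.sq_sqrt hr0.le, Real.sq_sqrt (by positivity)]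
    have : 0 ≤ K * (2 * N + 1) * B ^ 2 := by positivity
    nlinarith [sq_nonneg B]

lemma norm_inner_le_of_le {f g : L2Per Ξ} {x y : ℝ} (hf : ‖f‖ ≤ x) (hg : ‖g‖ ≤ y) :
    ‖(inner ℂ f g : ℂ)‖ ≤ x * y :=
  (norm_inner_le_norm f g).trans
    (mul_le_mul hf hg (norm_nonneg _) ((norm_nonneg _).trans hf))

/-- The energy estimate for the parabolic resolvent equation
`z w - c D w - D (a D w + p w + G₁) - q w = G₀`. -/
lemma parabolic_bound (hΞ : 0 < Ξ) (c : ℝ) {a p q : Coef Ξ} {a₀ : ℝ} (ha₀ : 0 < a₀)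
    (ha : ∀ x, a₀ ≤ (a x).re) :
    ∃ C R : ℝ, 0 ≤ C ∧ 1 ≤ R ∧ ∀ (ξ : ℝ) (z : ℂ), R ≤ ‖z‖ → -1 ≤ z.re →
      ∀ (w w₁ G₁ G₀ : L2Per Ξ) (B : ℝ), BD ξ w w₁ →
        BD ξ (a • w₁ + p • w + G₁) (z • w - (c : ℂ) • w₁ - q • w - G₀) →
        ‖G₁‖ ≤ B → ‖G₀‖ ≤ B → ‖w₁‖ ≤ C * B ∧ ‖w‖ ≤ C * B / √‖z‖ := by
  obtain ⟨M, hM0, hM⟩ := a.exists_norm_smul_le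
  obtain ⟨P, hP0, hP⟩ := p.exists_norm_smul_le
  obtain ⟨Q, hQ0, hQ⟩ := q.exists_norm_smul_le
  obtain ⟨C, R, hC, hR, key⟩ := real_energy_bound ha₀ (abs_nonneg c) hM0 hP0 hQ0
  refine ⟨C, R, hC, hR, fun ξ z hz hre w w₁ G₁ G₀ B h h' h1 h0 => ?_⟩
  -- The equation tested with w: skew-adjointness moves D from the flux onto w.
  have id1 := h.inner_skew hΞ h'
  simp only [inner_add_right, inner_sub_right, inner_smul_right] at id1
  have id2 : (inner ℂ w w : ℂ) = ((‖w‖ ^ 2 : ℝ) : ℂ) := by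
    rw [inner_self_eq_norm_sq_to_K]; simp
  rw [id2] at id1
  have bq := norm_inner_le_of_le (le_refl ‖w‖) (hQ w)
  have b0 := norm_inner_le_of_le (le_refl ‖w‖) h0
  have ba := norm_inner_le_of_le (le_refl ‖w₁‖) (hM w₁)
  have bp := norm_inner_le_of_le (le_refl ‖w₁‖) (hP w)
  have b1 := norm_inner_le_of_le (le_refl ‖w₁‖) h1
  have bc := norm_inner_le_of_le (le_refl ‖w‖) (le_refl ‖w₁‖)
  refine key ‖z‖ ‖w‖ ‖w₁‖ B hz (norm_nonneg _) (norm_nonneg _) ((norm_nonneg _).trans h0) ?_ ?_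
  · have hpos := Coef.le_re_inner_smul ha w₁
    have hre0 := h.re_inner_self hΞ
    have id3 := congrArg Complex.re id1
    simp only [Complex.add_re, Complex.sub_re, Complex.neg_re, Complex.re_mul_ofReal,
      Complex.re_ofReal_mul, hre0] at id3
    have r1 := (abs_le.1 (Complex.abs_re_le_norm (inner ℂ w (q • w)))).2
    have r2 := (abs_le.1 (Complex.abs_re_le_norm (inner ℂ w G₀))).2
    have r3 := (abs_le.1 (Complex.abs_re_le_norm (inner ℂ w₁ (p • w)))).1
    have r4 := (abs_le.1 (Complex.abs_re_le_norm (inner ℂ w₁ G₁))).1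
    nlinarith [sq_nonneg ‖w‖]
  -- The real part says nothing about a large imaginary part of z, so the same identity is now
  -- solved for z ‖w‖² and bounded in modulus.
  · have id4 : z * ((‖w‖ ^ 2 : ℝ) : ℂ) = (c : ℂ) * inner ℂ w w₁ + inner ℂ w (q • w)
        + inner ℂ w G₀ - inner ℂ w₁ (a • w₁) - inner ℂ w₁ (p • w) - inner ℂ w₁ G₁ := by
      linear_combination id1
    have n1 : ‖z‖ * ‖w‖ ^ 2 = ‖z * ((‖w‖ ^ 2 : ℝ) : ℂ)‖ := by
      rw [norm_mul, Complex.norm_real, Real.norm_of_nonneg (by positivity)]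
    have n2 : ‖(c : ℂ) * inner ℂ w w₁‖ ≤ |c| * (‖w‖ * ‖w₁‖) := by
      rw [norm_mul, Complex.norm_real, Real.norm_eq_abs]; gcongr
    rw [n1, id4]
    refine (norm_sub_le _ _).trans ?_
    refine (add_le_add_left ((norm_sub_le _ _).trans (add_le_add_left ((norm_sub_le _ _).trans
      (add_le_add_left ((norm_add_le _ _).trans (add_le_add_left (norm_add_le _ _) _)) _)) _))
      _).trans ?_
    nlinarith

/-- Induction on the order: D w solves the same equation with the same `a`, `p`, `q`, and the
commutators a' D w + p' w and q' w, already controlled, join the sources. -/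
lemma parabolic_sob (hΞ : 0 < Ξ) (c : ℝ) {a m p q : Coef Ξ} (hm : m * a = 1) {a₀ : ℝ}
    (ha₀ : 0 < a₀) (ha : ∀ x, a₀ ≤ (a x).re) (n : ℕ) :
    ∃ C R : ℝ, 0 ≤ C ∧ 1 ≤ R ∧ ∀ (ξ : ℝ) (z : ℂ), R ≤ ‖z‖ → -1 ≤ z.re →
      ∀ (w w₁ G₁ G₀ : L2Per Ξ) (B : ℝ), BD ξ w w₁ →
        BD ξ (a • w₁ + p • w + G₁) (z • w - (c : ℂ) • w₁ - q • w - G₀) →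
        Sob ξ n G₁ B → Sob ξ n G₀ B → Sob ξ n w₁ (C * B) ∧ Sob ξ n w (C * B / √‖z‖) := by
  induction n with
  | zero => exact parabolic_bound hΞ c ha₀ ha
  | succ n ih =>
    obtain ⟨C, R, hC, hR, ih⟩ := ih
    have sa := mulBound_nonneg n a.der
    have sp := mulBound_nonneg n p.der
    have sq := mulBound_nonneg n q.der
    set S := mulBound n a.der + mulBound n p.der + mulBound n q.der with hS
    refine ⟨C * (1 + S * C) + C, R, by positivity, hR, ?_⟩
    intro ξ z hz hre w w₁ G₁ G₀ B h h' hG₁ hG₀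
    have hB := hG₁.nonneg
    obtain ⟨-, G₁', hd1, hG₁'⟩ := id hG₁
    obtain ⟨-, G₀', hd0, hG₀'⟩ := id hG₀
    obtain ⟨k1, k0⟩ := ih ξ z hz hre w w₁ G₁ G₀ B h h' hG₁.of_succ hG₀.of_succ
    have hz1 : 1 ≤ √‖z‖ := Real.one_le_sqrt.2 (hR.trans hz)
    have k0' : Sob ξ n w (C * B) := k0.mono (div_le_self (by positivity) hz1)
    have haw := ((h'.sub (h.coef_smul p)).sub hd1).of_eq
      (show _ = a • w₁ by abel) rfl
    have hw₁ := (haw.coef_smul m).of_eq (show _ = w₁ by rw [← mul_smul, hm, one_smul]) rfl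
    -- The second derivative of w, read off from w₁ = m (a w₁), where the flux equation supplies D(a
    -- w₁).
    set w₂ := m.der • a • w₁ + m • (z • w - (c : ℂ) • w₁ - q • w - G₀ -
      (p.der • w + p • w₁) - G₁') with hw₂
    have huniq := (hw₁.coef_smul a).unique haw
    have hX := (((h.smul z).sub (hw₁.smul c)).sub (h.coef_smul q)).sub hd0
    have hnew : BD ξ (a • w₂ + p • w₁ + (a.der • w₁ + p.der • w + G₁'))
        (z • w₁ - (c : ℂ) • w₂ - q • w₁ - (q.der • w + G₀')) := by
      refine hX.of_eq ?_ ?_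
      · linear_combination (norm := module) -huniq
      · module
    have hB1 : Sob ξ n (a.der • w₁ + p.der • w + G₁') ((1 + S * C) * B) := by
      refine (((k1.coef a.der).add (k0'.coef p.der)).add hG₁').mono ?_
      rw [hS]; nlinarith [mul_nonneg sq (mul_nonneg hC hB)]
    have hB0 : Sob ξ n (q.der • w + G₀') ((1 + S * C) * B) := by
      refine ((k0'.coef q.der).add hG₀').mono ?_
      rw [hS]; nlinarith [mul_nonneg sa (mul_nonneg hC hB), mul_nonneg sp (mul_nonneg hC hB)]
    obtain ⟨l1, l0⟩ := ih ξ z hz hre w₁ w₂ _ _ _ hw₁ hnew hB1 hB0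
    have e1 : C * B ≤ (C * (1 + S * C) + C) * B := by
      have : 0 ≤ C * (1 + S * C) * B := by positivity
      linarith
    have e2 : C * ((1 + S * C) * B) ≤ (C * (1 + S * C) + C) * B := by
      have : 0 ≤ C * B := by positivity
      linarith
    constructor
    · exact Sob.succ_of_bd hw₁ (k1.mono e1) (l1.mono e2)
    · exact Sob.succ_of_bd h (k0.mono (by gcongr)) (l0.mono (by gcongr))

/-- The energy estimate for the damped transport equation `z σ - c D σ + d σ = g`. -/
lemma transport_sob (hΞ : 0 < Ξ) {c : ℝ} (hc : c ≠ 0) {d : Coef Ξ} {d₀ : ℝ} (hd₀ : 0 < d₀)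
    (hd : ∀ x, d₀ ≤ (d x).re) (n : ℕ) :
    ∃ C : ℝ, 0 ≤ C ∧ ∀ (ξ : ℝ) (z : ℂ), -(d₀ / 2) ≤ z.re → ∀ (σ σ₁ g : L2Per Ξ) (B : ℝ),
      BD ξ σ σ₁ → z • σ - (c : ℂ) • σ₁ + d • σ = g → Sob ξ n g B → Sob ξ n σ (C * B) := by
  induction n with
  | zero =>
    refine ⟨2 / d₀, by positivity, fun ξ z hz σ σ₁ g B h he hg => ?_⟩
    have hg : ‖g‖ ≤ B := hg
    have h1 := norm_inner_le_of_le (le_refl ‖σ‖) hg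
    -- Testing with σ: the transport term has zero real part, and Re z + d₀ ≥ d₀/2 remains.
    have h2 := (Complex.re_le_norm _).trans h1
    rw [← he, inner_add_right, inner_sub_right, inner_smul_right, inner_smul_right,
      inner_self_eq_norm_sq_to_K, Complex.add_re, Complex.sub_re, Complex.re_ofReal_mul,
      h.re_inner_self hΞ, mul_zero, sub_zero, RCLike.ofReal_eq_complex_ofReal,
      ← Complex.ofReal_pow, Complex.re_mul_ofReal] at h2
    have h3 := Coef.le_re_inner_smul hd σ
    change ‖σ‖ ≤ 2 / d₀ * B
    rw [div_mul_eq_mul_div, le_div_iff₀ hd₀]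
    by_contra hcon
    have hpos : 0 < ‖σ‖ := by
      by_contra h0
      have h0 : ‖σ‖ = 0 := le_antisymm (not_lt.1 h0) (norm_nonneg _)
      have := (norm_nonneg g).trans hg
      rw [h0] at hcon; linarith
    nlinarith [sq_nonneg ‖σ‖]
  | succ n ih =>
    obtain ⟨C, hC, ih⟩ := ih
    have sd := mulBound_nonneg n d.der
    refine ⟨C * (1 + mulBound n d.der * C) + C, by positivity, ?_⟩
    intro ξ z hz σ σ₁ g B h he hg
    have hB := hg.nonneg
    obtain ⟨-, g', hg', hgs⟩ := id hg
    have hc' : (c : ℂ) ≠ 0 := by exact_mod_cast hc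
    have k0 := ih ξ z hz σ σ₁ g B h he hg.of_succ
    have hσ₁ := ((((h.smul z).add (h.coef_smul d)).sub hg').smul (c : ℂ)⁻¹).of_eq
      (show _ = σ₁ by
        rw [← he, inv_smul_eq_iff₀ hc']; module) rfl
    -- As c ≠ 0, the equation expresses D σ through σ and g, hence D σ is differentiable too; it
    -- solves the same equation with source g' - d' σ.
    set σ₂ := (c : ℂ)⁻¹ • (z • σ₁ + (d.der • σ + d • σ₁) - g') with hσ₂
    have e2 : (c : ℂ) • σ₂ = z • σ₁ + (d.der • σ + d • σ₁) - g' := smul_inv_smul₀ hc' _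
    have k1 := ih ξ z hz σ₁ σ₂ (g' - d.der • σ) _ hσ₁
      (by rw [e2]; module) (hgs.sub (k0.coef d.der))
    refine Sob.succ_of_bd h (k0.mono ?_) (k1.mono ?_)
    · have : 0 ≤ C * (1 + mulBound n d.der * C) * B := by positivity
      linarith
    · have : 0 ≤ C * B := by positivity
      linarith

end energy

/-! ### The resolvent estimate -/

/-- The resolvent equation of the linearized system, in terms of its coefficients:
`z τ - f₁ = c D τ + D u` and `D (c u + α τ + a D u) = z u - f₂ + e₁ τ + e₂ u`. -/
structure ResolventEq {Ξ : ℝ} (c : ℝ) (a α e₁ e₂ : Coef Ξ) (ξ : ℝ) (z : ℂ)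
    (τ u τ₁ u₁ f₁ f₂ : L2Per Ξ) : Prop where
  bd_tau : BD ξ τ τ₁
  bd_u : BD ξ u u₁
  eq_tau : z • τ - f₁ = (c : ℂ) • τ₁ + u₁
  bd_flux : BD ξ ((c : ℂ) • u + α • τ + a • u₁) (z • u - f₂ + e₁ • τ + e₂ • u)

-- The a priori bound `A` returns with factor 1/2, ready for absorption. The multiplier `b` is the
-- weight that makes the damping positive, and `hd` says that d = m α + c b'/b.
set_option maxHeartbeats 1000000 in
theorem resolvent_sob {Ξ : ℝ} (hΞ : 0 < Ξ) {c : ℝ} (hc : c ≠ 0) {a m α b b' d : Coef Ξ}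
    (e₁ e₂ : Coef Ξ) (hm : m * a = 1) (hb : b' * b = 1)
    (hd : algebraMap ℂ (Coef Ξ) c * b.der + m * α * b = d * b)
    {a₀ d₀ : ℝ} (ha₀ : 0 < a₀) (ha : ∀ x, a₀ ≤ (a x).re) (hd₀ : 0 < d₀)
    (hdd : ∀ x, d₀ ≤ (d x).re) (n : ℕ) :
    ∃ C R : ℝ, 0 < C ∧ 0 < R ∧ ∀ (ξ : ℝ) (z : ℂ), R ≤ ‖z‖ → -(min 1 (d₀ / 2)) ≤ z.re →
      ∀ (τ u τ₁ u₁ f₁ f₂ : L2Per Ξ) (A B : ℝ), ResolventEq c a α e₁ e₂ ξ z τ u τ₁ u₁ f₁ f₂ →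
        Sob ξ n τ A → Sob ξ n u A → Sob ξ n f₁ B → Sob ξ n f₂ B →
        Sob ξ n τ (C * B + A / 2) ∧ Sob ξ n u (C * B + A / 2) := by
  -- `q` and `r` are the order-zero coefficients of v and τ left in the equation for v after
  -- replacing D u by m (v - α τ).
  set q : Coef Ξ := a.der.der + α * m - algebraMap ℂ (Coef Ξ) c * a.der * m with hq
  set r : Coef Ξ := α * m * α + algebraMap ℂ (Coef Ξ) c * α.der
    - algebraMap ℂ (Coef Ξ) c * a.der * m * α with hr
  obtain ⟨Cp, Rp, hCp, hRp, hpar⟩ := parabolic_sob hΞ c (p := -a.der) (q := q) hm ha₀ ha n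
  obtain ⟨Ct, hCt, htr⟩ := transport_sob hΞ hc hd₀ hdd n
  have s := mulBound_nonneg (Ξ := Ξ) n
  set K₁ := 1 + mulBound n e₁ + mulBound n e₂ with hK₁
  have hK₁0 : 0 ≤ K₁ := by have := s e₁; have := s e₂; positivity
  set K₂ := mulBound n a * K₁ + (mulBound n a.der * K₁ + mulBound n α + mulBound n r) with hK₂
  have hK₂0 : 0 ≤ K₂ := by
    have := s a; have := s a.der; have := s α; have := s r; positivity
  set K₃ := Cp * K₂ + |c| * (mulBound n m * (Cp * K₂ + mulBound n α)) + K₁ with hK₃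
  have hK₃0 : 0 ≤ K₃ := by have := s m; have := s α; positivity
  set K₄ := mulBound n b' * (Ct * (mulBound n b * (1 + mulBound n m * (Cp * K₂)))) with hK₄
  have hK₄0 : 0 ≤ K₄ := by have := s m; have := s b; have := s b'; positivity
  -- Beyond this radius, 2K₃ ≤ |z| and 2K₄ ≤ √|z|: the gains 1/|z| for u and 1/√|z| for τ turn the
  -- constants into 1/2.
  refine ⟨K₄ + 1, max Rp ((2 * (K₃ + K₄) + 1) ^ 2), by positivity, by positivity, ?_⟩
  intro ξ z hz hre τ u τ₁ u₁ f₁ f₂ A B h hτ hu hf₁ hf₂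
  have hA := hτ.nonneg
  have hB := hf₁.nonneg
  have hzp : Rp ≤ ‖z‖ := (le_max_left _ _).trans hz
  have hz1 : 1 ≤ ‖z‖ := hRp.trans hzp
  have hsq : 2 * (K₃ + K₄) + 1 ≤ √‖z‖ := Real.le_sqrt_of_sq_le ((le_max_right _ _).trans hz)
  have hz0 : z ≠ 0 := norm_pos_iff.1 (by linarith)
  have hsq1 : 1 ≤ √‖z‖ := by linarith
  have hsqz : √‖z‖ ≤ ‖z‖ :=
    Real.sqrt_le_iff.2 ⟨norm_nonneg z, le_self_pow₀ hz1 two_ne_zero⟩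
  set F₂ := f₂ - e₁ • τ - e₂ • u with hF₂
  set v := α • τ + a • u₁ with hv
  set v₁ := z • u - F₂ - (c : ℂ) • u₁ with hv₁
  have bF₂ : Sob ξ n F₂ (K₁ * (A + B)) := by
    refine ((hf₂.sub (hτ.coef e₁)).sub (hu.coef e₂)).mono ?_
    rw [hK₁]; linarith [mul_nonneg (s e₁) hB, mul_nonneg (s e₂) hB]
  have hbv : BD ξ v v₁ := (h.bd_flux.sub (h.bd_u.smul c)).of_eq (by rw [hv]; module)
    (by rw [hv₁, hF₂]; module)
  have hu₁ : u₁ = m • (v - α • τ) := by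
    rw [hv, add_sub_cancel_left, ← mul_smul, hm, one_smul]
  have hmu : (m * a) • u₁ = u₁ := by rw [hm, one_smul]
  -- The flux equals z a u - c a D u - a' v. In its derivative the -a' v term cancels z a' u, and c
  -- α D τ = α (z τ - f₁ - D u) cancels the -z α τ coming from z a D u. Keeping a F₂ inside the flux
  -- avoids differentiating the data.
  have hmain : BD ξ (a • v₁ + (-a.der) • v + a • F₂)
      (z • v - (c : ℂ) • v₁ - q • v - (-(a.der • F₂) + α • f₁ - r • τ)) := by
    have k1 := ((h.bd_u.coef_smul a).smul z).sub (hbv.smul c)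
    have k2 := (k1.add ((h.bd_tau.coef_smul α).smul c)).sub (hbv.coef_smul a.der)
    refine k2.of_eq ?_ ?_
    · rw [hv₁, hv]; module
    · rw [hq, hr]
      have e2 : (α * m) • a • u₁ = α • u₁ := by
        rw [← mul_smul, mul_assoc, hm, mul_one]
      have e3 : (a.der * m) • a • u₁ = a.der • u₁ := by
        rw [← mul_smul, mul_assoc, hm, mul_one]
      have e4 : (α * m) • v = (α * m * α) • τ + α • u₁ := by
        rw [hv, smul_add, e2, mul_smul (α * m)]
      have e5 : (a.der * m) • v = (a.der * m * α) • τ + a.der • u₁ := by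
        rw [hv, smul_add, e3, mul_smul (a.der * m)]
      linear_combination (norm := (simp only [hv, hv₁]; module))
        e4 - (c : ℂ) • e5 - α • h.eq_tau
  have hS : 0 ≤ A + B := by positivity
  have bG₁ : Sob ξ n (a • F₂) (K₂ * (A + B)) := by
    refine (bF₂.coef a).mono ?_
    have := s a.der; have := s α; have := s r
    have : 0 ≤ (mulBound n a.der * K₁ + mulBound n α + mulBound n r) * (A + B) := by positivity
    rw [hK₂]; linarith
  have bG₀ : Sob ξ n (-(a.der • F₂) + α • f₁ - r • τ) (K₂ * (A + B)) := by
    refine (((bF₂.coef a.der).neg.add (hf₁.coef α)).sub (hτ.coef r)).mono ?_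
    have := s a; have := s α; have := s r
    have : 0 ≤ mulBound n a * K₁ * (A + B) + mulBound n α * A + mulBound n r * B := by positivity
    rw [hK₂]; linarith
  obtain ⟨bv₁, bv⟩ := hpar ξ z hzp ((neg_le_neg (min_le_left _ _)).trans hre) v v₁ _ _ _ hbv
    hmain bG₁ bG₀
  have hdiv : Cp * (K₂ * (A + B)) / √‖z‖ ≤ Cp * (K₂ * (A + B)) :=
    div_le_self (by positivity) hsq1
  constructor
  · have hσ := h.bd_tau.coef_smul b
    -- The damped transport equation for b τ. Its forcing contains v, already small like 1/√|z|.
    have heq : z • b • τ - (c : ℂ) • (b.der • τ + b • τ₁) + d • b • τ = b • (f₁ + m • v) := by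
      have e1 : d • b • τ = (c : ℂ) • b.der • τ + (m * α * b) • τ := by
        rw [← mul_smul, ← hd, add_smul, mul_smul (algebraMap ℂ (Coef Ξ) c), algebraMap_smul]
      have e2 : u₁ = m • v - (m * α) • τ := by rw [hu₁]; module
      have e3 := h.eq_tau
      rw [e2] at e3
      linear_combination (norm := module) e1 + b • e3
    have bg := (hf₁.add (bv.coef m)).coef b
    have bτ := (htr ξ z ((neg_le_neg (min_le_right _ _)).trans hre) _ _ _ _ hσ heq bg).coef b'
    rw [← mul_smul, hb, one_smul] at bτ
    refine bτ.mono ?_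
    have e1 : mulBound n b' * (Ct * (mulBound n b * (B + mulBound n m *
        (Cp * (K₂ * (A + B)) / √‖z‖)))) ≤ K₄ * B + K₄ * ((A + B) / √‖z‖) := by
      have p1 : 0 ≤ mulBound n b' * (Ct * (mulBound n b * (mulBound n m * (Cp * K₂)))) * B := by
        have := s m; have := s b; have := s b'; positivity
      have p2 : 0 ≤ mulBound n b' * (Ct * mulBound n b) * ((A + B) / √‖z‖) := by
        have := s m; have := s b; have := s b'; positivity
      rw [hK₄]
      calc _ = mulBound n b' * (Ct * mulBound n b) * B + mulBound n b' * (Ct * (mulBound n b *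
            (mulBound n m * (Cp * K₂)))) * ((A + B) / √‖z‖) := by ring
        _ ≤ _ := by linarith
    have e2 : K₄ * ((A + B) / √‖z‖) ≤ (A + B) / 2 := by
      rw [mul_div_assoc', div_le_div_iff₀ (by linarith) two_pos]
      linarith [mul_le_mul_of_nonneg_left (show 2 * K₄ ≤ √‖z‖ by linarith) hS]
    linarith
  · have bu₁ : Sob ξ n u₁ (mulBound n m * ((Cp * K₂ + mulBound n α) * (A + B))) := by
      rw [hu₁]
      refine ((bv.mono hdiv).sub (hτ.coef α)).coef m |>.mono ?_
      have := mul_nonneg (s α) hB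
      have := s m
      gcongr
      linarith
    -- Here D v only needs to be bounded, since the final division by z supplies the smallness.
    have bzu : Sob ξ n (z • u) (K₃ * (A + B)) := by
      have e : z • u = v₁ + (c : ℂ) • u₁ + F₂ := by rw [hv₁]; module
      rw [e]
      refine ((bv₁.add (bu₁.smul c)).add bF₂).mono ?_
      rw [Complex.norm_real, Real.norm_eq_abs, hK₃]
      linarith
    have bu := bzu.smul z⁻¹
    rw [inv_smul_smul₀ hz0] at bu
    refine bu.mono ?_
    rw [norm_inv, inv_mul_eq_div, div_le_iff₀ (by linarith)]
    have : K₃ * (A + B) ≤ (A + B) / 2 * ‖z‖ := by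
      linarith [mul_le_mul_of_nonneg_left (show 2 * K₃ ≤ ‖z‖ by linarith) hS]
    have : 0 ≤ (K₄ + 1 / 2) * B * ‖z‖ := by positivity
    linarith

/-! ### Regularity of the profile -/

namespace IsRollWave

variable {F ν c Ξ : ℝ} {τ u : ℝ → ℝ}

lemma period_pos (h : IsRollWave F ν c Ξ τ u) : 0 < Ξ := h.fundamental_period.1.1

lemma periodic_tau (h : IsRollWave F ν c Ξ τ u) : Function.Periodic τ Ξ :=
  h.fundamental_period.1.2.1

lemma periodic_u (h : IsRollWave F ν c Ξ τ u) : Function.Periodic u Ξ :=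
  h.fundamental_period.1.2.2

lemma deriv_u (h : IsRollWave F ν c Ξ τ u) (x : ℝ) : deriv u x = -c * deriv τ x := by
  have := h.profile_tau x; linarith

lemma differentiable_tau (h : IsRollWave F ν c Ξ τ u) : Differentiable ℝ τ :=
  h.contDiff_tau.differentiable (by norm_num)

lemma exists_max (h : IsRollWave F ν c Ξ τ u) : ∃ x, ∀ y, τ y ≤ τ x := by
  obtain ⟨x, -, hx⟩ := (isCompact_Icc (a := (0 : ℝ)) (b := Ξ)).exists_isMaxOn
    (Set.nonempty_Icc.2 h.period_pos.le) h.contDiff_tau.continuous.continuousOn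
  refine ⟨x, fun y => ?_⟩
  obtain ⟨y', hy', e⟩ := h.periodic_tau.exists_mem_Ico₀ h.period_pos y
  rw [e]; exact hx ⟨hy'.1, hy'.2.le⟩

lemma exists_min (h : IsRollWave F ν c Ξ τ u) : ∃ x, ∀ y, τ x ≤ τ y := by
  obtain ⟨x, -, hx⟩ := (isCompact_Icc (a := (0 : ℝ)) (b := Ξ)).exists_isMinOn
    (Set.nonempty_Icc.2 h.period_pos.le) h.contDiff_tau.continuous.continuousOn
  refine ⟨x, fun y => ?_⟩
  obtain ⟨y', hy', e⟩ := h.periodic_tau.exists_mem_Ico₀ h.period_pos y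
  rw [e]; exact hx ⟨hy'.1, hy'.2.le⟩

lemma hasDerivAt_inv_sq (h : IsRollWave F ν c Ξ τ u) (x : ℝ) :
    HasDerivAt (fun y => (τ y ^ 2)⁻¹) (-(2 * deriv τ x) * (τ x ^ 3)⁻¹) x := by
  have h0 := (h.tau_pos x).ne'
  refine (((h.differentiable_tau x).hasDerivAt.pow 2).inv (pow_ne_zero 2 h0)).congr_deriv ?_
  norm_num
  field_simp

lemma deriv_pressure (h : IsRollWave F ν c Ξ τ u) (x : ℝ) :
    deriv (fun y => (2 * F ^ 2)⁻¹ * (τ y ^ 2)⁻¹) x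
      = (2 * F ^ 2)⁻¹ * (-(2 * deriv τ x) * (τ x ^ 3)⁻¹) :=
  ((h.hasDerivAt_inv_sq x).const_mul _).deriv

/-- A roll wave of speed zero would be constant, hence without fundamental period. -/
lemma speed_ne_zero (h : IsRollWave F ν c Ξ τ u) : c ≠ 0 := by
  rintro rfl
  have hu' : ∀ x, deriv u x = 0 := fun x => by simpa using h.deriv_u x
  have hu : ∀ x, u x = u 0 := fun x =>
    is_const_of_deriv_eq_zero (h.contDiff_u.differentiable (by norm_num)) hu' x 0
  -- With c = 0 and u constant, only the pressure gradient and 1 - τ u² survive. Evaluating at the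
  -- maximum and the minimum of τ makes these equal.
  have hcrit : ∀ x, deriv τ x = 0 → τ x * u 0 ^ 2 = 1 := fun x hx => by
    have := h.profile_u x
    rw [h.deriv_pressure, hx] at this
    simp only [hu', mul_zero, deriv_const, hu x] at this
    linarith
  obtain ⟨x, hx⟩ := h.exists_max
  obtain ⟨y, hy⟩ := h.exists_min
  have h1 := hcrit x (IsLocalMax.deriv_eq_zero (.of_forall hx))
  have h2 := hcrit y (IsLocalMin.deriv_eq_zero (.of_forall hy))
  have hu0 : u 0 ^ 2 ≠ 0 := fun e => by rw [e, mul_zero] at h1; exact zero_ne_one h1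
  have hxy : τ x = τ y := mul_right_cancel₀ hu0 (h1.trans h2.symm)
  have hτ : ∀ t, τ t = τ x := fun t => le_antisymm (hx t) (hxy ▸ hy t)
  have hΞ := h.period_pos
  have := h.fundamental_period.2 (show Ξ / 2 ∈ _ from
    ⟨by linarith, fun t => by rw [hτ, hτ t], fun t => by rw [hu, hu t]⟩)
  linarith

/-- Bootstrap: since c ≠ 0, (τ, u, p) with p = τ⁻² u' solves a first-order system with right-hand
side smooth in (τ, u, p) for τ > 0. -/
lemma smooth (hν : 0 < ν) (h : IsRollWave F ν c Ξ τ u) :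
    ContDiff ℝ (⊤ : ℕ∞) τ ∧ ContDiff ℝ (⊤ : ℕ∞) u := by
  have hc := h.speed_ne_zero
  set p : ℝ → ℝ := fun y => (τ y ^ 2)⁻¹ * deriv u y with hp
  have hτ0 : ∀ x, τ x ≠ 0 := fun x => (h.tau_pos x).ne'
  have hu' : deriv u = fun x => τ x ^ 2 * p x := by
    ext x; have := hτ0 x; simp only [hp]; field_simp
  have hτ' : deriv τ = fun x => -c⁻¹ * (τ x ^ 2 * p x) := by
    ext x
    have e : τ x ^ 2 * p x = -c * deriv τ x := by rw [← h.deriv_u, hu']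
    rw [e]; field_simp
  have hdu : ContDiff ℝ 1 (deriv u) :=
    ((contDiff_succ_iff_deriv (n := 1)).1 (by simpa [one_add_one_eq_two] using h.contDiff_u)).2.2
  have hp1 : ContDiff ℝ 1 p :=
    (((h.contDiff_tau.of_le (by norm_num)).pow 2).inv fun x => pow_ne_zero 2 (hτ0 x)).mul hdu
  have hp' : deriv p = fun x => ν⁻¹ * (-c * (τ x ^ 2 * p x)
      + (2 * F ^ 2)⁻¹ * (-(2 * (-c⁻¹ * (τ x ^ 2 * p x))) * (τ x ^ 3)⁻¹)
      - 1 + τ x * u x ^ 2) := by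
    ext x
    have e := h.profile_u x
    rw [h.deriv_pressure, show deriv u x = _ from congrFun hu' x,
      show deriv τ x = _ from congrFun hτ' x] at e
    change _ = _ + ν * deriv p x at e
    rw [eq_inv_mul_iff_mul_eq₀ hν.ne']
    linarith
  have key : ∀ n : ℕ, ContDiff ℝ n τ ∧ ContDiff ℝ n u ∧ ContDiff ℝ n p := by
    intro n
    induction n with
    | zero =>
      simp only [Nat.cast_zero, contDiff_zero]
      exact ⟨h.contDiff_tau.continuous, h.contDiff_u.continuous, hp1.continuous⟩
    | succ n ih =>
      obtain ⟨i1, i2, i3⟩ := ih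
      have j1 : ContDiff ℝ n fun x => τ x ^ 2 * p x := (i1.pow 2).mul i3
      have j2 : ContDiff ℝ n fun x => (τ x ^ 3)⁻¹ := (i1.pow 3).inv fun x => pow_ne_zero 3 (hτ0 x)
      simp only [Nat.cast_add, Nat.cast_one, contDiff_succ_iff_deriv]
      refine ⟨⟨h.differentiable_tau, by simp, ?_⟩,
        ⟨h.contDiff_u.differentiable (by norm_num), by simp, ?_⟩,
        ⟨hp1.differentiable (by norm_num), by simp, ?_⟩⟩
      · rw [hτ']; exact contDiff_const.mul j1
      · rw [hu']; exact j1
      · rw [hp']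
        exact contDiff_const.mul ((((contDiff_const.mul j1).add (contDiff_const.mul
          ((contDiff_const.mul (contDiff_const.mul j1)).neg.mul j2))).sub contDiff_const).add
          (i1.mul (i2.pow 2)))
  exact ⟨contDiff_infty.2 fun n => (key n).1, contDiff_infty.2 fun n => (key n).2.1⟩

end IsRollWave

/-! ### Coefficients of the linearization and the transport weight -/

/-- A real smooth periodic function as a coefficient. -/
def Coef.ofReal {Ξ : ℝ} (f : ℝ → ℝ) (hf : ContDiff ℝ (⊤ : ℕ∞) f)
    (hp : Function.Periodic f Ξ) : Coef Ξ :=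
  ⟨fun x => (f x : ℂ), Complex.ofRealCLM.contDiff.comp hf, fun x => congrArg _ (hp x)⟩

@[simp] lemma Coef.ofReal_apply {Ξ : ℝ} (f : ℝ → ℝ) (hf : ContDiff ℝ (⊤ : ℕ∞) f)
    (hp : Function.Periodic f Ξ) (x : ℝ) : Coef.ofReal f hf hp x = (f x : ℂ) := rfl

/-- The coefficients of the linearized system about a roll wave: `a = ν τ⁻²`, `α`, `e₁ = u²` and
`e₂ = 2 u τ`, with the weight `b = τ⁻²` for which the damping `d` of `τ⁻² σ` is positive. -/
lemma IsRollWave.exists_coefs {F ν c Ξ : ℝ} {τ u : ℝ → ℝ} (hF : 0 < F) (hν : 0 < ν)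
    (h : IsRollWave F ν c Ξ τ u) : ∃ (a m α e₁ e₂ b b' d : Coef Ξ) (a₀ d₀ : ℝ),
    (∀ x, a x = (ν : ℂ) * (((τ x ^ 2)⁻¹ : ℝ) : ℂ)) ∧ (∀ x, α x = (alpha F ν τ u x : ℂ)) ∧
    (∀ x, e₁ x = ((u x ^ 2 : ℝ) : ℂ)) ∧ (∀ x, e₂ x = ((2 * u x * τ x : ℝ) : ℂ)) ∧
    m * a = 1 ∧ b' * b = 1 ∧ algebraMap ℂ (Coef Ξ) c * b.der + m * α * b = d * b ∧
    0 < a₀ ∧ (∀ x, a₀ ≤ (a x).re) ∧ 0 < d₀ ∧ ∀ x, d₀ ≤ (d x).re := by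
  obtain ⟨sτ, su⟩ := h.smooth hν
  have hτ0 : ∀ x, τ x ≠ 0 := fun x => (h.tau_pos x).ne'
  have pτ := h.periodic_tau
  have pu := h.periodic_u
  have sdu : ContDiff ℝ (⊤ : ℕ∞) (deriv u) := (contDiff_infty_iff_deriv.1 su).2
  have pdu : Function.Periodic (deriv u) Ξ := fun x => by
    rw [h.deriv_u, h.deriv_u, ← deriv_comp_add_const]
    congr 2
    exact funext pτ
  have sb : ContDiff ℝ (⊤ : ℕ∞) fun x => (τ x ^ 2)⁻¹ :=
    (sτ.pow 2).inv fun x => pow_ne_zero 2 (hτ0 x)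
  have pb : Function.Periodic (fun x => (τ x ^ 2)⁻¹) Ξ := fun x => by simp only [pτ x]
  have sα : ContDiff ℝ (⊤ : ℕ∞) (alpha F ν τ u) :=
    ((sτ.pow 3).inv fun x => pow_ne_zero 3 (hτ0 x)).mul
      (contDiff_const.sub (contDiff_const.mul sdu))
  have sd : ContDiff ℝ (⊤ : ℕ∞) fun x => (ν * F ^ 2)⁻¹ * (τ x)⁻¹ :=
    contDiff_const.mul (sτ.inv hτ0)
  have pa : Function.Periodic (fun x => ν * (τ x ^ 2)⁻¹) Ξ := fun x => by simp only [pτ x]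
  have pm : Function.Periodic (fun x => ν⁻¹ * τ x ^ 2) Ξ := fun x => by simp only [pτ x]
  have pα : Function.Periodic (alpha F ν τ u) Ξ := fun x => by simp only [alpha, pτ x, pdu x]
  have pe₁ : Function.Periodic (fun x => u x ^ 2) Ξ := fun x => by simp only [pu x]
  have pe₂ : Function.Periodic (fun x => 2 * u x * τ x) Ξ := fun x => by simp only [pu x, pτ x]
  have pb' : Function.Periodic (fun x => τ x ^ 2) Ξ := fun x => by simp only [pτ x]
  have pd : Function.Periodic (fun x => (ν * F ^ 2)⁻¹ * (τ x)⁻¹) Ξ := fun x => by simp only [pτ x]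
  obtain ⟨x₀, hx₀⟩ := h.exists_max
  have hT := h.tau_pos x₀
  refine ⟨Coef.ofReal _ (contDiff_const.mul sb) pa,
    Coef.ofReal _ (contDiff_const.mul (sτ.pow 2)) pm,
    Coef.ofReal _ sα pα,
    Coef.ofReal _ (su.pow 2) pe₁, Coef.ofReal _ ((contDiff_const.mul su).mul sτ) pe₂,
    Coef.ofReal _ sb pb, Coef.ofReal _ (sτ.pow 2) pb',
    Coef.ofReal _ sd pd,
    -- Both lower bounds are the values at the maximum of τ, since a and d decrease in τ.
    ν * (τ x₀ ^ 2)⁻¹, (ν * F ^ 2)⁻¹ * (τ x₀)⁻¹,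
    fun x => by simp, fun x => rfl, fun x => rfl, fun x => rfl, ?_, ?_, ?_, by positivity, ?_,
    by positivity, ?_⟩
  · ext x
    have := hτ0 x
    simp only [Coef.mul_apply, Coef.ofReal_apply, Coef.one_apply]
    norm_cast
    field_simp
  · ext x
    have := hτ0 x
    simp only [Coef.mul_apply, Coef.ofReal_apply, Coef.one_apply]
    norm_cast
    field_simp
  -- The slope part -2u'/τ of m α equals 2c τ'/τ and cancels c b'/b = -2c τ'/τ.
  · ext x
    have h0 := hτ0 x
    have hd := ((Coef.ofReal _ sb pb).hasDerivAt x).unique (h.hasDerivAt_inv_sq x).ofReal_comp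
    have hC : algebraMap ℂ (Coef Ξ) c x = (c : ℂ) := rfl
    simp only [Coef.mul_apply, Coef.add_apply, Coef.ofReal_apply, hd, hC, alpha, h.deriv_u]
    norm_cast
    field_simp
    ring
  · intro x
    have := h.tau_pos x
    rw [Coef.ofReal_apply, Complex.ofReal_re]
    gcongr
    exact hx₀ x
  · intro x
    have := h.tau_pos x
    rw [Coef.ofReal_apply, Complex.ofReal_re]
    gcongr
    exact hx₀ x

/-! ### Solvability of first-order systems -/

lemma exists_solution_of_unique {Ξ : ℝ} (hΞ : 0 < Ξ) (ξ : ℝ)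
    (A : L2Per Ξ × L2Per Ξ × L2Per Ξ →L[ℂ] L2Per Ξ × L2Per Ξ × L2Per Ξ)
    (hA : ∀ V, BD ξ V.1 (A V).1 → BD ξ V.2.1 (A V).2.1 → BD ξ V.2.2 (A V).2.2 → V = 0)
    (G : L2Per Ξ × L2Per Ξ × L2Per Ξ) :
    ∃ V, BD ξ V.1 (A V + G).1 ∧ BD ξ V.2.1 (A V + G).2.1 ∧ BD ξ V.2.2 (A V + G).2.2 := by
  obtain ⟨T, hTc, hT⟩ := exists_inverse_one_add hΞ ξ
  set S := T.prodMap (T.prodMap T) with hS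
  have hSc : IsCompactOperator S := by
    have e : (S : L2Per Ξ × L2Per Ξ × L2Per Ξ → L2Per Ξ × L2Per Ξ × L2Per Ξ)
        = (ContinuousLinearMap.inl ℂ (L2Per Ξ) (L2Per Ξ × L2Per Ξ)) ∘
            T ∘ (ContinuousLinearMap.fst ℂ (L2Per Ξ) (L2Per Ξ × L2Per Ξ))
          + ((ContinuousLinearMap.inr ℂ (L2Per Ξ) (L2Per Ξ × L2Per Ξ)).comp
              (ContinuousLinearMap.inl ℂ (L2Per Ξ) (L2Per Ξ))) ∘
            T ∘ ((ContinuousLinearMap.fst ℂ (L2Per Ξ) (L2Per Ξ)).comp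
              (ContinuousLinearMap.snd ℂ (L2Per Ξ) (L2Per Ξ × L2Per Ξ)))
          + ((ContinuousLinearMap.inr ℂ (L2Per Ξ) (L2Per Ξ × L2Per Ξ)).comp
              (ContinuousLinearMap.inr ℂ (L2Per Ξ) (L2Per Ξ))) ∘
            T ∘ ((ContinuousLinearMap.snd ℂ (L2Per Ξ) (L2Per Ξ)).comp
              (ContinuousLinearMap.snd ℂ (L2Per Ξ) (L2Per Ξ × L2Per Ξ))) := by
      ext V <;> simp [hS]
    rw [e]
    exact (((hTc.comp_clm _).clm_comp _).add ((hTc.comp_clm _).clm_comp _)).add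
      ((hTc.comp_clm _).clm_comp _)
  -- D V = A V + G is equivalent to V = S ((A + 1) V + G): a compact perturbation of the identity,
  -- for which injectivity gives surjectivity.
  have hK : IsCompactOperator (S.comp (A + 1)) := hSc.comp_clm (A + 1)
  have hsol : ∀ V W, V = S W →
      BD ξ V.1 (W - V).1 ∧ BD ξ V.2.1 (W - V).2.1 ∧ BD ξ V.2.2 (W - V).2.2 := by
    rintro _ W rfl
    exact ⟨hT W.1, hT W.2.1, hT W.2.2⟩
  rcases hK.hasEigenvalue_or_mem_resolventSet one_ne_zero with h | h
  · obtain ⟨V, hV⟩ := h.exists_hasEigenvector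
    have h1 := hV.apply_eq_smul
    rw [one_smul] at h1
    have h2 := hsol V ((A + 1) V) h1.symm
    have e : (A + 1) V - V = A V := by simp
    rw [e] at h2
    exact absurd (hA V h2.1 h2.2.1 h2.2.2) hV.2
  · rw [spectrum.mem_resolventSet_iff] at h
    obtain ⟨V, hV⟩ := (ContinuousLinearMap.isUnit_iff_bijective.1 h).2 (S G)
    refine ⟨V, ?_⟩
    have h2 := hsol V ((A + 1) V + G) (by
      rw [map_add, ← hV]; simp)
    have e : (A + 1) V + G - V = A V + G := by simp; abel
    rwa [e] at h2

section resolventEq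

variable {Ξ c : ℝ} {a m α e₁ e₂ : Coef Ξ} {ξ : ℝ} {z : ℂ}

/-- If the homogeneous resolvent equation has only the zero solution, the resolvent equation is
solvable. -/
lemma exists_resolventEq (hΞ : 0 < Ξ) (hc : c ≠ 0) (hm : m * a = 1)
    (huniq : ∀ τ u τ₁ u₁, ResolventEq c a α e₁ e₂ ξ z τ u τ₁ u₁ 0 0 → τ = 0 ∧ u = 0)
    (f₁ f₂ : L2Per Ξ) : ∃ τ u τ₁ u₁, ResolventEq c a α e₁ e₂ ξ z τ u τ₁ u₁ f₁ f₂ := by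
  have hc' : (c : ℂ) ≠ 0 := by exact_mod_cast hc
  let P₁ := ContinuousLinearMap.fst ℂ (L2Per Ξ) (L2Per Ξ × L2Per Ξ)
  let P₂ := (ContinuousLinearMap.fst ℂ (L2Per Ξ) (L2Per Ξ)).comp
    (ContinuousLinearMap.snd ℂ (L2Per Ξ) (L2Per Ξ × L2Per Ξ))
  let P₃ := (ContinuousLinearMap.snd ℂ (L2Per Ξ) (L2Per Ξ)).comp
    (ContinuousLinearMap.snd ℂ (L2Per Ξ) (L2Per Ξ × L2Per Ξ))
  -- The three unknowns are τ, u and the full flux w = c u + α τ + a D u; `D₂` recovers D u from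
  -- them.
  let D₂ := m.mulL.comp (P₃ - (c : ℂ) • P₂ - α.mulL.comp P₁)
  let A := ((c : ℂ)⁻¹ • (z • P₁ - D₂)).prod
    (D₂.prod (z • P₂ + e₁.mulL.comp P₁ + e₂.mulL.comp P₂))
  have hA : ∀ V, A V = ((c : ℂ)⁻¹ • (z • V.1 - m • (V.2.2 - (c : ℂ) • V.2.1 - α • V.1)),
    m • (V.2.2 - (c : ℂ) • V.2.1 - α • V.1), z • V.2.1 + e₁ • V.1 + e₂ • V.2.1) := fun V => rfl
  have ham : ∀ f : L2Per Ξ, a • m • f = f := fun f => by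
    rw [← mul_smul, mul_comm, hm, one_smul]
  have key : ∀ V f₁ f₂, BD ξ V.1 (A V + (-(c : ℂ)⁻¹ • f₁, 0, -f₂)).1 →
      BD ξ V.2.1 (A V + (-(c : ℂ)⁻¹ • f₁, 0, -f₂)).2.1 →
      BD ξ V.2.2 (A V + (-(c : ℂ)⁻¹ • f₁, 0, -f₂)).2.2 →
      ResolventEq c a α e₁ e₂ ξ z V.1 V.2.1
        ((c : ℂ)⁻¹ • (z • V.1 - m • (V.2.2 - (c : ℂ) • V.2.1 - α • V.1) - f₁))
        (m • (V.2.2 - (c : ℂ) • V.2.1 - α • V.1)) f₁ f₂ := by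
    intro V f₁ f₂ h1 h2 h3
    rw [hA] at h1 h2 h3
    refine ⟨h1.of_eq rfl ?_, h2.of_eq rfl (add_zero _), ?_, h3.of_eq ?_ ?_⟩
    · change _ + -(c : ℂ)⁻¹ • f₁ = _
      module
    · rw [smul_inv_smul₀ hc']; abel
    · rw [ham]; abel
    · change _ + -f₂ = _
      module
  obtain ⟨V, h1, h2, h3⟩ := exists_solution_of_unique hΞ ξ A (by
    intro V h1 h2 h3
    have hz : A V + (-(c : ℂ)⁻¹ • (0 : L2Per Ξ), 0, -(0 : L2Per Ξ)) = A V := by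
      rw [smul_zero, neg_zero]; exact add_zero _
    have hR := key V 0 0 (by rwa [hz]) (by rwa [hz]) (by rwa [hz])
    obtain ⟨hτ, hu⟩ := huniq _ _ _ _ hR
    have hb := hR.bd_u
    rw [hu] at hb
    have h0 : BD ξ (0 : L2Per Ξ) 0 := by simpa using hb.smul 0
    have hu₁ := hb.unique h0
    rw [hτ] at hu₁
    simp only [smul_zero, sub_zero] at hu₁
    have hw := ham V.2.2
    rw [hu₁, smul_zero] at hw
    exact Prod.ext hτ (Prod.ext hu hw.symm)) (-(c : ℂ)⁻¹ • f₁, 0, -f₂)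
  exact ⟨_, _, _, _, key V f₁ f₂ h1 h2 h3⟩

/-- Solutions of the resolvent equation are as regular as the right-hand side. -/
lemma ResolventEq.regularity (hc : c ≠ 0) (hm : m * a = 1) {τ u τ₁ u₁ f₁ f₂ : L2Per Ξ}
    (h : ResolventEq c a α e₁ e₂ ξ z τ u τ₁ u₁ f₁ f₂) {n : ℕ} {B : ℝ}
    (hf₁ : Sob ξ n f₁ B) (hf₂ : Sob ξ n f₂ B) : ∃ A, Sob ξ n τ A ∧ Sob ξ n u A := by
  have hc' : (c : ℂ) ≠ 0 := by exact_mod_cast hc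
  set w := (c : ℂ) • u + α • τ + a • u₁ with hw
  have hu₁ : u₁ = m • (w - (c : ℂ) • u - α • τ) := by
    have : w - (c : ℂ) • u - α • τ = a • u₁ := by rw [hw]; abel
    rw [this, ← mul_smul, hm, one_smul]
  have hτ₁ : τ₁ = (c : ℂ)⁻¹ • (z • τ - f₁ - u₁) := by
    rw [h.eq_tau, add_sub_cancel_right, inv_smul_smul₀ hc']
  -- D τ, D u and D w are order-zero combinations of τ, u, w and the data, so each pass gains one
  -- derivative.
  have key : ∀ k, k ≤ n → ∃ A, Sob ξ k τ A ∧ Sob ξ k u A ∧ Sob ξ k w A := by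
    have hle : ∀ k (f : L2Per Ξ), k ≤ n → Sob ξ n f B → Sob ξ k f B := by
      intro k f hk hf
      induction hk using Nat.decreasingInduction with
      | self => exact hf
      | of_succ k _ ih => exact ih.of_succ
    intro k hk
    induction k with
    | zero =>
      exact ⟨max ‖τ‖ (max ‖u‖ ‖w‖), le_max_left _ _, (le_max_left _ _).trans (le_max_right _ _),
        (le_max_right _ _).trans (le_max_right _ _)⟩
    | succ k ih =>
      obtain ⟨A, i1, i2, i3⟩ := ih (by omega)
      have g1 := hle k f₁ (by omega) hf₁
      have g2 := hle k f₂ (by omega) hf₂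
      have j1 := (((i3.sub (i2.smul c)).sub (i1.coef α)).coef m)
      rw [← hu₁] at j1
      have j2 := ((((i1.smul z).sub g1).sub j1).smul (c : ℂ)⁻¹)
      rw [← hτ₁] at j2
      have j3 := (((i2.smul z).sub g2).add (i1.coef e₁)).add (i2.coef e₂)
      have l1 := Sob.succ_of_bd h.bd_tau (i1.mono (le_max_left _ _)) (j2.mono (le_max_right _ _))
      have l2 := Sob.succ_of_bd h.bd_u (i2.mono (le_max_left _ _)) (j1.mono (le_max_right _ _))
      have l3 := Sob.succ_of_bd h.bd_flux (i3.mono (le_max_left _ _)) (j3.mono (le_max_right _ _))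
      exact ⟨_, l1.mono (le_max_left _ _),
        l2.mono ((le_max_left _ _).trans (le_max_right _ _)),
        l3.mono ((le_max_right _ _).trans (le_max_right _ _))⟩
  obtain ⟨A, h1, h2, -⟩ := key n le_rfl
  exact ⟨A, h1, h2⟩

end resolventEq

/-! ### Periodic Sobolev spaces -/

section hper

variable {Ξ ξ : ℝ}

/-- Uniqueness of weak derivatives identifies the stored tuple with the successive derivatives in
`Sob`; the least admissible `A` is the largest component norm. -/
lemma sob_iff_forall_norm_le {s : ℕ} {f : Fin (s + 1) → L2Per Ξ}
    (hf : ∀ k : Fin s, BD ξ (f k.castSucc) (f k.succ)) {A : ℝ} :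
    Sob ξ s (f 0) A ↔ ∀ k, ‖f k‖ ≤ A := by
  induction s with
  | zero =>
    refine ⟨fun h k => ?_, fun h => h 0⟩
    obtain rfl : k = 0 := Fin.ext (by omega)
    exact h
  | succ s ih =>
    have h0 : BD ξ (f 0) (f 1) := hf 0
    have ih' := ih (f := fun k => f k.succ) (fun k => hf k.succ)
    change Sob ξ s (f 1) A ↔ _ at ih'
    rw [Fin.forall_fin_succ (n := s + 1)]
    constructor
    · intro h
      exact ⟨h.norm_le, ih'.1 (h.of_bd h0)⟩
    · rintro ⟨h1, h2⟩
      exact ⟨h1, _, h0, ih'.2 h2⟩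

lemma Sob.exists_hPer {s : ℕ} {f : L2Per Ξ} {A : ℝ} (h : Sob ξ s f A) :
    ∃ g : HPer Ξ ξ s, g.1 0 = f := by
  have key : ∃ g : Fin (s + 1) → L2Per Ξ, g 0 = f ∧
      ∀ k : Fin s, BD ξ (g k.castSucc) (g k.succ) := by
    induction s generalizing f with
    | zero => exact ⟨fun _ => f, rfl, fun k => k.elim0⟩
    | succ s ih =>
      obtain ⟨-, f', h1, h2⟩ := h
      obtain ⟨g, hg0, hg⟩ := ih h2
      refine ⟨Fin.cons f g, rfl, fun k => ?_⟩
      refine Fin.cases ?_ (fun k => ?_) k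
      · simpa [hg0] using h1
      · simpa [← Fin.succ_castSucc] using hg k
  obtain ⟨g, hg0, hg⟩ := key
  exact ⟨⟨WithLp.toLp 2 g, hg⟩, hg0⟩

lemma HPer.sob_norm {s : ℕ} (f : HPer Ξ ξ s) : Sob ξ s (f.1 0) ‖f‖ :=
  (sob_iff_forall_norm_le f.2).2 fun k => PiLp.norm_apply_le f.1 k

lemma HPer.norm_le {s : ℕ} {f : HPer Ξ ξ s} {A : ℝ} (h : Sob ξ s (f.1 0) A) :
    ‖f‖ ≤ (s + 1) * A := by
  have hA := h.nonneg
  have h := (sob_iff_forall_norm_le f.2).1 h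
  change ‖f.1‖ ≤ _
  refine (abs_le_of_sq_le_sq' ?_ (by positivity)).2
  rw [PiLp.norm_sq_eq_of_L2]
  calc _ ≤ ∑ _k : Fin (s + 1), A ^ 2 := Finset.sum_le_sum fun k _ => by gcongr; exact h k
    _ = (s + 1) * A ^ 2 := by simp
    _ ≤ _ := by rw [mul_pow]; gcongr; nlinarith [(Nat.cast_nonneg s : (0 : ℝ) ≤ s)]

end hper

/-! ### The resolvent of the Bloch symbols -/

section main

variable {F ν c Ξ : ℝ} {τb ub : ℝ → ℝ} {ξ : ℝ} {s : ℕ}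

/-- Bridge from the pointwise graph to the equation in L². The number z is free, because z U - (z U
- G) = G. -/
lemma mem_blochGraph_iff {a α e₁ e₂ : Coef Ξ}
    (ha : ∀ x, a x = (ν : ℂ) * (((τb x ^ 2)⁻¹ : ℝ) : ℂ))
    (hα : ∀ x, α x = (alpha F ν τb ub x : ℂ)) (he₁ : ∀ x, e₁ x = ((ub x ^ 2 : ℝ) : ℂ))
    (he₂ : ∀ x, e₂ x = ((2 * ub x * τb x : ℝ) : ℂ)) (z : ℂ) (U G : HPer2 Ξ ξ s) :
    (U, G) ∈ blochGraph F ν c Ξ τb ub ξ s ↔ ∃ τ₁ u₁ : L2Per Ξ,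
      ResolventEq c a α e₁ e₂ ξ z (U.fst.1 0) (U.snd.1 0) τ₁ u₁
        ((z • U - G).fst.1 0) ((z • U - G).snd.1 0) := by
  have e1 : (z • U - G).fst.1 0 = z • U.fst.1 0 - G.fst.1 0 := rfl
  have e2 : (z • U - G).snd.1 0 = z • U.snd.1 0 - G.snd.1 0 := rfl
  rw [e1, e2]
  have hflux : ∀ u₁ : L2Per Ξ, ((c : ℂ) • U.snd.1 0 + α • U.fst.1 0 + a • u₁ : L2Per Ξ)
      =ᵐ[periodMeasure Ξ] fun x => (c : ℂ) * perFn U.snd x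
        + (alpha F ν τb ub x : ℂ) * perFn U.fst x
        + (ν : ℂ) * (((τb x ^ 2)⁻¹ : ℝ) : ℂ) * u₁ x := by
    intro u₁
    filter_upwards [Lp.coeFn_add ((c : ℂ) • U.snd.1 0 + α • U.fst.1 0) (a • u₁),
      Lp.coeFn_add ((c : ℂ) • U.snd.1 0) (α • U.fst.1 0), Lp.coeFn_smul (c : ℂ) (U.snd.1 0),
      Coef.coeFn_smul α (U.fst.1 0), Coef.coeFn_smul a u₁] with x h1 h2 h3 h4 h5
    rw [h1, Pi.add_apply, h2, Pi.add_apply, h3, h4, h5, hα, ha]; rfl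
  have hsrc : (G.snd.1 0 + e₁ • U.fst.1 0 + e₂ • U.snd.1 0 : L2Per Ξ)
      =ᵐ[periodMeasure Ξ] fun x => perFn G.snd x + ((ub x ^ 2 : ℝ) : ℂ) * perFn U.fst x
        + ((2 * ub x * τb x : ℝ) : ℂ) * perFn U.snd x := by
    filter_upwards [Lp.coeFn_add (G.snd.1 0 + e₁ • U.fst.1 0) (e₂ • U.snd.1 0),
      Lp.coeFn_add (G.snd.1 0) (e₁ • U.fst.1 0), Coef.coeFn_smul e₁ (U.fst.1 0),
      Coef.coeFn_smul e₂ (U.snd.1 0)] with x h1 h2 h3 h4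
    rw [h1, Pi.add_apply, h2, Pi.add_apply, h3, h4, he₁, he₂]; rfl
  constructor
  · rintro ⟨dτ, du, h1, h2, h3, h4⟩
    have t1 := h1.2.1.coeFn_toLp
    have t2 := h2.2.1.coeFn_toLp
    refine ⟨h1.2.1.toLp dτ, h2.2.1.toLp du, h1.congr (.refl _ _) t1.symm,
      h2.congr (.refl _ _) t2.symm, ?_, h4.congr ?_ ?_⟩
    · rw [sub_sub_cancel]
      ext1
      filter_upwards [h3, t1, t2, Lp.coeFn_add ((c : ℂ) • h1.2.1.toLp dτ) (h2.2.1.toLp du),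
        Lp.coeFn_smul (c : ℂ) (h1.2.1.toLp dτ)] with x k1 k2 k3 k4 k5
      rw [k4, Pi.add_apply, k5, Pi.smul_apply, k2, k3]
      exact k1
    · refine Filter.EventuallyEq.trans ?_ (hflux _).symm
      filter_upwards [t2] with x k
      rw [k]
    · rw [sub_sub_cancel]
      exact hsrc.symm
  · rintro ⟨τ₁, u₁, h⟩
    refine ⟨τ₁, u₁, h.bd_tau, h.bd_u, ?_, HasWeakBlochDeriv.congr h.bd_flux (hflux u₁) ?_⟩
    · have := h.eq_tau
      rw [sub_sub_cancel] at this
      filter_upwards [Lp.coeFn_add ((c : ℂ) • τ₁) u₁, Lp.coeFn_smul (c : ℂ) τ₁] with x k1 k2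
      change (G.fst.1 0 : L2Per Ξ) x = _
      rw [this, k1, Pi.add_apply, k2, Pi.smul_apply, smul_eq_mul]
    · rw [sub_sub_cancel]
      exact hsrc

/-- A solution operator for `z U - A U = f`, given unique solvability and an a priori bound. -/
lemma exists_resolvent {E : Type*} [NormedAddCommGroup E] [NormedSpace ℂ E] (A : E →ₗ.[ℂ] E)
    (z : ℂ) {C : ℝ} (hC : 0 ≤ C) (hsol : ∀ f, ∃ U, (U, z • U - f) ∈ A.graph)
    (hbd : ∀ U f, (U, z • U - f) ∈ A.graph → ‖U‖ ≤ C * ‖f‖) :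
    z ∉ unboundedSpectrum A ∧ ‖unboundedResolvent A z‖ ≤ C := by
  -- The bound at f = 0 gives uniqueness, which in turn makes the chosen solution map linear.
  have huniq : ∀ U U' f, (U, z • U - f) ∈ A.graph → (U', z • U' - f) ∈ A.graph → U = U' := by
    intro U U' f h h'
    have h0 := hbd (U - U') 0 (by
      have := A.graph.sub_mem h h'
      have e : z • (U - U') - 0 = z • U - f - (z • U' - f) := by module
      rw [e]; exact this)
    rw [norm_zero, mul_zero] at h0
    exact sub_eq_zero.1 (norm_le_zero_iff.1 h0)
  choose S hS using hsol
  let S₀ : E →ₗ[ℂ] E :=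
    { toFun := S
      map_add' := fun f g => by
        refine huniq _ _ _ (hS (f + g)) ?_
        have e : z • (S f + S g) - (f + g) = z • S f - f + (z • S g - g) := by module
        rw [e]; exact A.graph.add_mem (hS f) (hS g)
      map_smul' := fun r f => by
        refine huniq _ _ _ (hS (r • f)) ?_
        have e : z • (r • S f) - r • f = r • (z • S f - f) := by module
        rw [RingHom.id_apply, e]; exact A.graph.smul_mem r (hS f) }
  have hres : IsResolventAt A z (S₀.mkContinuous C fun f => hbd _ f (hS f)) := by
    constructor
    · intro f
      obtain ⟨y, hy1, hy2⟩ := (LinearPMap.mem_graph_iff A).1 (hS f)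
      change (y : E) = S f at hy1
      change A y = z • S f - f at hy2
      refine ⟨by change S f ∈ _; rw [← hy1]; exact y.2, ?_⟩
      have e : (⟨S f, by rw [← hy1]; exact y.2⟩ : A.domain) = y := Subtype.ext hy1.symm
      change z • S f - A ⟨S f, _⟩ = f
      rw [e, hy2, sub_sub_cancel]
    · intro v
      refine huniq _ _ _ (hS _) ?_
      rw [sub_sub_cancel]
      exact A.mem_graph v
  have hex : ∃ R : E →L[ℂ] E, IsResolventAt A z R := ⟨_, hres⟩
  refine ⟨fun h => h hex, ?_⟩
  rw [unboundedResolvent, dif_pos hex]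
  -- Any resolvent, whichever one is chosen, solves the equation, so the a priori bound applies to
  -- it.
  refine ContinuousLinearMap.opNorm_le_bound _ hC fun f => hbd _ f ?_
  obtain ⟨h, he⟩ := hex.choose_spec.1 f
  have e : z • hex.choose f - f = A ⟨hex.choose f, h⟩ := sub_eq_of_eq_add (sub_eq_iff_eq_add'.1 he)
  rw [e]
  exact A.mem_graph ⟨_, h⟩

end main

end StVenant

end

/-! ### Conclusion: solvability at order zero, bounds at order s -/

theorem mainTheorem2 (F ν c Ξ : ℝ) (hF : 0 < F) (hν : 0 < ν) (τb ub : ℝ → ℝ)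
    (hwave : StVenant.IsRollWave F ν c Ξ τb ub) (s : ℕ) (hs : 0 < s) :
    ∃ η C R : ℝ, 0 < η ∧ 0 < C ∧ 0 < R ∧
      ∀ ξ ∈ Set.Ico (-(Real.pi / Ξ)) (Real.pi / Ξ), ∀ z : ℂ, R ≤ ‖z‖ → -η ≤ z.re →
        z ∉ StVenant.unboundedSpectrum (StVenant.blochOperator F ν c Ξ τb ub ξ s) ∧
        ‖StVenant.unboundedResolvent (StVenant.blochOperator F ν c Ξ τb ub ξ s) z‖ ≤ C := by
  open StVenant in
  have hΞ := hwave.period_pos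
  have hc := hwave.speed_ne_zero
  obtain ⟨a, m, α, e₁, e₂, b, b', d, a₀, d₀, ha, hα, he₁, he₂, hm, hb, hd, ha₀, haa, hd₀, hdd⟩ :=
    hwave.exists_coefs hF hν
  obtain ⟨C₀, R₀, hC₀, hR₀, est₀⟩ :=
    resolvent_sob hΞ hc e₁ e₂ hm hb hd ha₀ haa hd₀ hdd 0
  obtain ⟨C, R, hC, hR, est⟩ := resolvent_sob hΞ hc e₁ e₂ hm hb hd ha₀ haa hd₀ hdd s
  -- The factors are: 2 for the two components, s + 1 for passing from the largest derivative norm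
  -- to the ℓ² norm, and 2 for absorbing A/2. The radius serves both orders 0 and s.
  refine ⟨min 1 (d₀ / 2), 2 * ((s + 1) * (2 * C)), max R₀ R, by positivity, by positivity,
    lt_max_of_lt_left hR₀, ?_⟩
  intro ξ _ z hz hre
  have hz0 := (le_max_left _ _).trans hz
  have hz1 := (le_max_right _ _).trans hz
  refine exists_resolvent _ z (by positivity) ?_ ?_
  · intro f
    have hn1 : ‖f.fst‖ ≤ ‖f‖ := WithLp.norm_fst_le _ f
    have hn2 : ‖f.snd‖ ≤ ‖f‖ := WithLp.norm_snd_le _ f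
    -- Uniqueness must hold for mere L² solutions, so the order-zero estimate is used: with no data,
    -- A ≤ A/2.
    obtain ⟨τ, u, τ₁, u₁, h⟩ := exists_resolventEq (e₁ := e₁) (e₂ := e₂) (α := α) (ξ := ξ) (z := z)
      hΞ hc hm (fun τ u τ₁ u₁ h => by
        have h0 : Sob ξ 0 (0 : L2Per Ξ) 0 := norm_zero.le
        obtain ⟨k1, k2⟩ := est₀ ξ z hz0 hre τ u τ₁ u₁ 0 0 (max ‖τ‖ ‖u‖) 0 h
          (le_max_left _ _) (le_max_right _ _) h0 h0
        have k3 := max_le k1.norm_le k2.norm_le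
        have k4 : max ‖τ‖ ‖u‖ ≤ 0 := by linarith
        exact ⟨norm_le_zero_iff.1 ((le_max_left _ _).trans k4),
          norm_le_zero_iff.1 ((le_max_right _ _).trans k4)⟩)
      (f.fst.1 0) (f.snd.1 0)
    obtain ⟨A, hA1, hA2⟩ := h.regularity hc hm ((HPer.sob_norm f.fst).mono hn1) ((HPer.sob_norm f.snd).mono hn2)
    obtain ⟨gτ, rfl⟩ := hA1.exists_hPer
    obtain ⟨gu, rfl⟩ := hA2.exists_hPer
    refine ⟨WithLp.toLp 2 (gτ, gu), ?_⟩
    rw [blochOperator_graph, mem_blochGraph_iff ha hα he₁ he₂ z, sub_sub_cancel]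
    exact ⟨τ₁, u₁, h⟩
  · intro U f h
    have hn1 : ‖f.fst‖ ≤ ‖f‖ := WithLp.norm_fst_le _ f
    have hn2 : ‖f.snd‖ ≤ ‖f‖ := WithLp.norm_snd_le _ f
    rw [blochOperator_graph, mem_blochGraph_iff ha hα he₁ he₂ z, sub_sub_cancel] at h
    obtain ⟨τ₁, u₁, h⟩ := h
    -- The sup norm over all derivatives of both components is the least bound in the `Sob` sense,
    -- so the estimate returns A ≤ C‖f‖ + A/2 for this same A.
    set A := max ‖WithLp.ofLp U.fst.1‖ ‖WithLp.ofLp U.snd.1‖ with hA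
    have s1 := fun A => sob_iff_forall_norm_le U.fst.2 (A := A)
    have s2 := fun A => sob_iff_forall_norm_le U.snd.2 (A := A)
    obtain ⟨k1, k2⟩ := est ξ z hz1 hre _ _ _ _ _ _ A ‖f‖ h
      ((s1 _).2 fun k => (norm_le_pi_norm (WithLp.ofLp U.fst.1) k).trans (le_max_left _ _))
      ((s2 _).2 fun k => (norm_le_pi_norm (WithLp.ofLp U.snd.1) k).trans (le_max_right _ _))
      ((HPer.sob_norm f.fst).mono hn1) ((HPer.sob_norm f.snd).mono hn2)
    have hA0 : A ≤ C * ‖f‖ + A / 2 := max_le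
      ((pi_norm_le_iff_of_nonneg k1.nonneg).2 ((s1 _).1 k1))
      ((pi_norm_le_iff_of_nonneg k2.nonneg).2 ((s2 _).1 k2))
    have hA1 : C * ‖f‖ + A / 2 ≤ 2 * C * ‖f‖ := by linarith
    have l1 := HPer.norm_le (k1.mono hA1)
    have l2 := HPer.norm_le (k2.mono hA1)
    have l3 : ‖U‖ ≤ ‖U.fst‖ + ‖U.snd‖ := by
      rw [WithLp.prod_norm_eq_of_L2]
      refine Real.sqrt_le_iff.2 ⟨by positivity, ?_⟩
      nlinarith [norm_nonneg U.fst, norm_nonneg U.snd]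
    linarith
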